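/- Conventions. Manifolds are smooth (real, finite-dimensional, without boundary, Hausdorff). An almost complex structure on $M$ is a smooth field $J$ of endomorphisms of the tangent spaces with $J^2=-\mathrm{Id}$, and $\nabla$ denotes a connection on $TM$ with torsion $T(X,Y)=\nabla_XY-\nabla_YX-[X,Y]$. A smooth map $f:N\to N'$ is $(A,A')$-holomorphic, for fields $A,A'$ of endomorphisms of the tangent spaces of $N,N'$, if $A'(f(x))\circ d_xf=d_xf\circ A(x)$ for every $x\in N$. Let $\pi:T^*M\to M$ be the projection. The connection induced by $\nabla$ on $T^*M$ is $(\nabla_Xs)(Y)=X.s(Y)-s(\nabla_XY)$. For $\xi\in T^*M$ with $\pi(\xi)=x$ put $$H^\nabla_\xi=\{d_xs(X)\;:\;X\in T_xM,\ s\in\Gamma(T^*M),\ s(x)=\xi,\ \nabla_Xs=0\}\subseteq T_\xi T^*M .$$ Then $d_\xi\pi$ maps $H^\nabla_\xi$ isomorphically onto $T_xM$, and $T_\xi T^*M=H^\nabla_\xi\oplus T^*_xM$, where $T^*_xM$ is identified with the vertical subspace. The generalized horizontal lift $J^{G,\nabla}$ of $J$ is the field of endomorphisms of $T(T^*M)$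 that at $\xi$ equals $J\oplus{}^tJ$ in this decomposition: it maps $Y\in H^\nabla_\xi$ to the element of $H^\nabla_\xi$ with projection $J(x)\,d_\xi\pi(Y)$, and it maps $\eta\in T^*_xM$ to $\eta\circ J(x)$. Define also the tensors $(\nabla J)(X,Y)=\nabla_X(JY)-J\nabla_XY$ and $$S(X,Y)=-(\nabla J)(X,Y)+(\nabla J)(Y,X)+T(JX,Y)-J\,T(X,Y).$$ Theorem. 1. Let $J$ be an almost complex structure and $\nabla$ a connection on $M$. The projection $\pi:T^*M\to M$ is $(J^{G,\nabla},J)$-holomorphic. 2. With $M,J,\nabla$ as in 1, the zero section $M\to T^*M$ is $(J,J^{G,\nabla})$-holomorphic. 3. For $i=1,2$ let $M_i$ be a manifold with an almost complex structure $J_i$ and a connection $\nabla_i$, and let $S_i$ be the tensor $S$ of $(J_i,\nabla_i)$. Let $f:M_1\to M_2$ be a diffeomorphism, with lift $\tilde f:T^*M_1\to T^*M_2$ given by $\tilde f(\xi)=\xi\circ(d_xf)^{-1}\in T^*_{f(x)}M_2$ for $\xi\in T^*_xM_1$. Then $\tilde f$ is $(J_1^{G,\nabla_1},J_2^{G,\nabla_2})$-holomorphic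 if and only if $f$ is $(J_1,J_2)$-holomorphic and $f_*S_1=S_2$, where $(f_*S_1)_{f(x)}(X,Y)=d_xf\big(S_1((d_xf)^{-1}X,(d_xf)^{-1}Y)\big)$. -/

import Mathlib

open Bundle Manifold
open scoped ContDiff Manifold Topology

noncomputable section

namespace CotangentLift

/-! ### The cotangent bundle and its splitting by a connection -/

/-- The cotangent space `T*_x M` of an `n`-dimensional manifold. -/
abbrev CotangentSpace (n : ℕ) {M : Type*} [TopologicalSpace M]
    [ChartedSpace (EuclideanSpace ℝ (Fin n)) M] (x : M) : Type :=
  TangentSpace (𝓡 n) x →L[ℝ] ℝ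

/-- The total space `T*M`, with the topology and smooth structure of a vector bundle that Mathlib
puts on the bundle `Hom(TM, ℝ)`. -/
abbrev CotangentBundle (n : ℕ) (M : Type*) [TopologicalSpace M]
    [ChartedSpace (EuclideanSpace ℝ (Fin n)) M] : Type _ :=
  TotalSpace (EuclideanSpace ℝ (Fin n) →L[ℝ] ℝ) (fun x : M => CotangentSpace n x)

/-- The model with corners of `T*M`. -/
abbrev cotangentModel (n : ℕ) :=
  (𝓡 n).prod 𝓘(ℝ, EuclideanSpace ℝ (Fin n) →L[ℝ] ℝ)

/-- A connection on the tangent bundle of `M`; `∇ Y x X` is `∇_X Y` at `x`. -/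
abbrev AffineConnection (n : ℕ) (M : Type*) [TopologicalSpace M]
    [ChartedSpace (EuclideanSpace ℝ (Fin n)) M] [IsManifold (𝓡 n) ∞ M] : Type _ :=
  CovariantDerivative (𝓡 n) (EuclideanSpace ℝ (Fin n)) (TangentSpace (𝓡 n) : M → Type _)

/-- Linear algebra: an endomorphism can be prescribed on the two factors of a splitting. -/
theorem existsUnique_product {T X C : Type*} [NormedAddCommGroup T] [NormedSpace ℝ T]
    [FiniteDimensional ℝ T] [NormedAddCommGroup X] [NormedSpace ℝ X] [NormedAddCommGroup C]
    [NormedSpace ℝ C] (p : T →L[ℝ] X) (v : T →L[ℝ] C) (i : C →L[ℝ] T) (H : Set T)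
    (J : X →L[ℝ] X) (J' : C →L[ℝ] C) (hpi : ∀ η, p (i η) = 0) (hvi : ∀ η, v (i η) = η)
    (hH : ∀ V, V ∈ H ↔ v V = 0) (hs : ∀ x, ∃ V ∈ H, p V = x)
    (hi : ∀ V, p V = 0 → v V = 0 → V = 0) :
    ∃! A : T →L[ℝ] T, (∀ V ∈ H, A V ∈ H) ∧ (∀ V ∈ H, p (A V) = J (p V)) ∧
      ∀ η, A (i η) = i (J' η) := by
  choose h hh hp using hs
  have hvh : ∀ x, v (h x) = 0 := fun x => (hH _).1 (hh x)
  have hext : ∀ V W, p V = p W → v V = v W → V = W := fun V W h1 h2 =>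
    sub_eq_zero.1 (hi _ (by rw [map_sub, h1, sub_self]) (by rw [map_sub, h2, sub_self]))
  let T₀ : T →ₗ[ℝ] T :=
    { toFun := fun V => h (J (p V)) + i (J' (v V))
      map_add' := fun V W => hext _ _ (by simp [hp, hpi]) (by simp [hvh, hvi])
      map_smul' := fun c V => hext _ _ (by simp [hp, hpi]) (by simp [hvh, hvi]) }
  refine ⟨LinearMap.toContinuousLinearMap T₀, ⟨fun V hV => ?_, fun V hV => ?_, fun η => ?_⟩, ?_⟩
  · rw [hH] at hV ⊢
    simp [T₀, hV, hvh]
  · simp [T₀, hp, hpi]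
  · exact hext _ _ (by simp [T₀, hp, hpi]) (by simp [T₀, hvh, hvi])
  · rintro B ⟨h1, h2, h3⟩
    refine ContinuousLinearMap.ext fun V => ?_
    have hV : V = h (p V) + i (v V) := hext _ _ (by simp [hp, hpi]) (by simp [hvh, hvi])
    have hB : B V = B (h (p V)) + i (J' (v V)) := by
      conv_lhs => rw [hV]
      rw [map_add, h3]
    refine hext _ _ ?_ ?_
    · rw [hB, map_add, h2 _ (hh _), hp]
      simp [T₀, hp, hpi]
    · rw [hB, map_add, (hH _).1 (h1 _ (hh _))]
      simp [T₀, hvh, hvi]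

section Defs

variable {n : ℕ} {M : Type*} [TopologicalSpace M]
    [ChartedSpace (EuclideanSpace ℝ (Fin n)) M] [IsManifold (𝓡 n) ∞ M]

/-- A vector field is smooth, i.e. is an element of `Γ(TM)`. -/
def SmoothField (Z : Π x : M, TangentSpace (𝓡 n) x) : Prop :=
  ContMDiff (𝓡 n) ((𝓡 n).prod 𝓘(ℝ, EuclideanSpace ℝ (Fin n))) ∞
    (fun x => TotalSpace.mk' (EuclideanSpace ℝ (Fin n)) x (Z x))

/-- The map `M → T*M` given by a one-form. -/
def sectionMap (s : Π x : M, CotangentSpace n x) (x : M) : CotangentBundle n M := ⟨x, s x⟩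

/-- The one-form is smooth, i.e. is an element of `Γ(T*M)`. -/
def SmoothForm (s : Π x : M, CotangentSpace n x) : Prop :=
  ContMDiff (𝓡 n) (cotangentModel n) ∞ (sectionMap s)

/-- The number `(∇_X s)(Z) = X.s(Z) - s(∇_X Z)` at `x`. -/
def dualDerivative (cov : AffineConnection n M) (s : Π x : M, CotangentSpace n x)
    (Z : Π x : M, TangentSpace (𝓡 n) x) (x : M) (X : TangentSpace (𝓡 n) x) : ℝ :=
  mvfderiv (𝓡 n) (fun y => s y (Z y)) x X - s x (cov Z x X)

/-- The horizontal space
`H_ξ = {d_x s (X) | X ∈ T_x M, s ∈ Γ(T*M), s(x) = ξ, ∇_X s = 0} ⊆ T_ξ T*M`, where `x = π(ξ)`. -/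
def horizontalSpace (cov : AffineConnection n M) (ξ : CotangentBundle n M) :
    Set (TangentSpace (cotangentModel n) ξ) :=
  {V | ∃ (s : Π x : M, CotangentSpace n x) (X : TangentSpace (𝓡 n) ξ.proj),
    SmoothForm s ∧ s ξ.proj = ξ.2 ∧
    (∀ Z : Π x : M, TangentSpace (𝓡 n) x, SmoothField Z → dualDerivative cov s Z ξ.proj X = 0) ∧
    tangentMap (𝓡 n) (cotangentModel n) (sectionMap s) ⟨ξ.proj, X⟩ = ⟨ξ, V⟩}

/-- The differential `d_ξ π : T_ξ T*M → T_x M`. -/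
def projDeriv (ξ : CotangentBundle n M) :
    TangentSpace (cotangentModel n) ξ →L[ℝ] TangentSpace (𝓡 n) ξ.proj :=
  mfderiv (cotangentModel n) (𝓡 n)
    (TotalSpace.proj : CotangentBundle n M → M) ξ

/-- The identification of `T*_x M` with the vertical subspace of `T_ξ T*M`: the differential at `ξ`
of the inclusion of the fibre through `ξ`. -/
def verticalLift (ξ : CotangentBundle n M) :
    CotangentSpace n ξ.proj →L[ℝ] TangentSpace (cotangentModel n) ξ :=
  mfderiv 𝓘(ℝ, EuclideanSpace ℝ (Fin n) →L[ℝ] ℝ) (cotangentModel n)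
    (fun p : EuclideanSpace ℝ (Fin n) →L[ℝ] ℝ => (⟨ξ.proj, p⟩ : CotangentBundle n M)) ξ.2

/-- The function `η ↦ η(Z)` on `T*M`. -/
def pairing (Z : Π x : M, TangentSpace (𝓡 n) x) (ξ : CotangentBundle n M) : ℝ :=
  ξ.2 (Z ξ.proj)

theorem pairing_mdiff {Z : Π x : M, TangentSpace (𝓡 n) x} {ξ : CotangentBundle n M}
    (hZ : MDifferentiableAt (𝓡 n) ((𝓡 n).prod 𝓘(ℝ, EuclideanSpace ℝ (Fin n)))
      (fun x => TotalSpace.mk' (EuclideanSpace ℝ (Fin n)) x (Z x)) ξ.proj) :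
    MDifferentiableAt (cotangentModel n) 𝓘(ℝ, ℝ) (pairing Z) ξ := by
  have h1 : MDifferentiableAt (cotangentModel n) ((𝓡 n).prod 𝓘(ℝ, ℝ))
      (fun ξ : CotangentBundle n M => TotalSpace.mk' ℝ (E := Bundle.Trivial M ℝ) ξ.proj
        (ξ.2 (Z ξ.proj))) ξ := by
    apply MDifferentiableAt.clm_bundle_apply (IB := 𝓡 n) (F₁ := EuclideanSpace ℝ (Fin n)) (F₂ := ℝ)
      (E₁ := (TangentSpace (𝓡 n) : M → Type _)) (E₂ := Bundle.Trivial M ℝ)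
      (b := fun ξ : CotangentBundle n M => ξ.proj) (ϕ := fun ξ => ξ.2)
      (v := fun ξ => Z ξ.proj)
    · exact mdifferentiableAt_id
    · exact MDifferentiableAt.comp (I' := 𝓡 n) ξ hZ
        (mdifferentiableAt_proj (E := fun x : M => CotangentSpace n x))
  rw [mdifferentiableAt_totalSpace] at h1
  exact h1.2

theorem fibre_mdiff (x : M) (p : EuclideanSpace ℝ (Fin n) →L[ℝ] ℝ) :
    MDifferentiableAt 𝓘(ℝ, EuclideanSpace ℝ (Fin n) →L[ℝ] ℝ) (cotangentModel n)
      (fun p : EuclideanSpace ℝ (Fin n) →L[ℝ] ℝ => (⟨x, p⟩ : CotangentBundle n M)) p := by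
  rw [mdifferentiableAt_totalSpace]
  refine ⟨mdifferentiableAt_const, ?_⟩
  let t := trivializationAt (EuclideanSpace ℝ (Fin n) →L[ℝ] ℝ)
    (fun x : M => CotangentSpace n x) x
  let L : (EuclideanSpace ℝ (Fin n) →L[ℝ] ℝ) →L[ℝ] (EuclideanSpace ℝ (Fin n) →L[ℝ] ℝ) :=
    (t.continuousLinearMapAt ℝ x : CotangentSpace n x →L[ℝ] _)
  have hL : ∀ q : EuclideanSpace ℝ (Fin n) →L[ℝ] ℝ,
      (t (⟨x, q⟩ : CotangentBundle n M)).2 = L q := by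
    intro q
    exact (congrFun (t.coe_linearMapAt_of_mem (R := ℝ)
      (FiberBundle.mem_baseSet_trivializationAt' x)) q).symm
  have h := L.differentiable.mdifferentiable p
  exact h.congr_of_eventuallyEq (Filter.Eventually.of_forall hL)

theorem exists_smooth {F : Type*} [NormedAddCommGroup F] [NormedSpace ℝ F] {V : M → Type*}
    [TopologicalSpace (TotalSpace F V)] [∀ x, AddCommGroup (V x)] [∀ x, Module ℝ (V x)]
    [∀ x, TopologicalSpace (V x)] [FiberBundle F V] [VectorBundle ℝ F V]
    [ContMDiffVectorBundle ∞ F V (𝓡 n)] [T2Space M] {x : M} (v : V x) :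
    ∃ s : Π x, V x, ContMDiff (𝓡 n) ((𝓡 n).prod 𝓘(ℝ, F)) ∞
      (fun y => TotalSpace.mk' F y (s y)) ∧ s x = v := by
  obtain ⟨u, hu, hs⟩ := FiberBundle.exists_contMDiffOn_extend (k := ∞) (𝓡 n) F v
  have hu' : interior u ∈ 𝓝 x := interior_mem_nhds.2 hu
  obtain ⟨ψ, -, hψ⟩ := (SmoothBumpFunction.nhds_basis_tsupport (I := 𝓡 n) x).mem_iff.1 hu'
  refine ⟨(ψ : M → ℝ) • FiberBundle.extend F v, ?_, ?_⟩
  · exact ContMDiffOn.smul_section_of_tsupport ψ.contMDiff.contMDiffOn isOpen_interior hψ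
      (hs.mono interior_subset)
  · simp

theorem exists_smoothField [T2Space M] {x : M} (z : TangentSpace (𝓡 n) x) :
    ∃ Z : Π x : M, TangentSpace (𝓡 n) x, SmoothField Z ∧ Z x = z :=
  exists_smooth (n := n) (F := EuclideanSpace ℝ (Fin n))
    (V := (TangentSpace (𝓡 n) : M → Type _)) z

theorem exists_smoothForm [T2Space M] {x : M} (p : CotangentSpace n x) :
    ∃ s : Π x : M, CotangentSpace n x, SmoothForm s ∧ s x = p :=
  exists_smooth (n := n) (F := EuclideanSpace ℝ (Fin n) →L[ℝ] ℝ)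
    (V := fun x : M => CotangentSpace n x) p

theorem exists_function [T2Space M] {x : M} {X : TangentSpace (𝓡 n) x} (hX : X ≠ 0) :
    ∃ g : M → ℝ, ContMDiff (𝓡 n) 𝓘(ℝ, ℝ) ∞ g ∧ g x = 0 ∧ mvfderiv (𝓡 n) g x X = 1 := by
  obtain ⟨ψ⟩ : Nonempty (SmoothBumpFunction (𝓡 n) x) := inferInstance
  let h : M → EuclideanSpace ℝ (Fin n) := fun y => ψ y • extChartAt (𝓡 n) x y
  have hh : ContMDiff (𝓡 n) 𝓘(ℝ, EuclideanSpace ℝ (Fin n)) ∞ h :=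
    ψ.contMDiff_smul (contMDiffOn_extChartAt (n := ∞))
  have he : h =ᶠ[𝓝 x] extChartAt (𝓡 n) x := by
    filter_upwards [ψ.eventuallyEq_one] with y hy
    simp [h, hy]
  have hd : mfderiv (𝓡 n) 𝓘(ℝ, EuclideanSpace ℝ (Fin n)) h x X ≠ 0 := by
    rw [he.mfderiv_eq]
    intro h0
    obtain ⟨e, he⟩ := isInvertible_mfderiv_extChartAt (I := 𝓡 n) (mem_extChartAt_source (I := 𝓡 n) x)
    rw [← he] at h0
    exact hX (e.map_eq_zero_iff.1 h0)
  let w : EuclideanSpace ℝ (Fin n) := mfderiv (𝓡 n) 𝓘(ℝ, EuclideanSpace ℝ (Fin n)) h x X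
  have hw : w ≠ 0 := hd
  obtain ⟨φ, hφ⟩ : ∃ φ : EuclideanSpace ℝ (Fin n) →L[ℝ] ℝ, φ w = 1 :=
    ⟨(‖w‖ ^ 2)⁻¹ • innerSL ℝ w, by
      have : ‖w‖ ^ 2 ≠ 0 := by positivity
      simp [this]⟩
  refine ⟨fun y => φ (h y) - φ (h x), ?_, by simp, ?_⟩
  · exact (φ.contMDiff.comp hh).sub contMDiff_const
  · have h1 : MDifferentiableAt (𝓡 n) 𝓘(ℝ, EuclideanSpace ℝ (Fin n)) h x :=
      (hh x).mdifferentiableAt (by simp)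
    have h2 : HasMFDerivAt (𝓡 n) 𝓘(ℝ, ℝ) (fun y => φ (h y)) x
        (φ ∘L mfderiv (𝓡 n) 𝓘(ℝ, EuclideanSpace ℝ (Fin n)) h x) :=
      HasMFDerivAt.comp x φ.hasMFDerivAt h1.hasMFDerivAt
    have h3 := h2.sub (hasMFDerivAt_const (I := 𝓡 n) (I' := 𝓘(ℝ, ℝ)) (φ (h x)) x)
    have h4 : mfderiv (𝓡 n) 𝓘(ℝ, ℝ) (fun y => φ (h y) - φ (h x)) x = _ := h3.mfderiv
    simp only [mvfderiv]
    rw [h4]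
    have h5 : (φ ∘L mfderiv (𝓡 n) 𝓘(ℝ, EuclideanSpace ℝ (Fin n)) h x) X = 1 := hφ
    have h6 : (φ ∘L mfderiv (𝓡 n) 𝓘(ℝ, EuclideanSpace ℝ (Fin n)) h x) - 0 =
      (φ ∘L mfderiv (𝓡 n) 𝓘(ℝ, EuclideanSpace ℝ (Fin n)) h x) := sub_zero _
    exact (DFunLike.congr_fun h6 X).trans h5

/-- The tensorial expression `Z ↦ d(pairing Z) - ξ(∇ Z) ∘ dπ` of the vertical projection. -/
theorem connector_tensorial (cov : AffineConnection n M) (ξ : CotangentBundle n M) :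
    TensorialAt (𝓡 n) (EuclideanSpace ℝ (Fin n))
      (fun Z : Π x : M, TangentSpace (𝓡 n) x =>
        mvfderiv (cotangentModel n) (pairing Z) ξ - (ξ.2 ∘L cov Z ξ.proj) ∘L projDeriv ξ)
      ξ.proj where
  smul {f σ} hf hσ := by
    have hp : MDifferentiableAt (cotangentModel n) (𝓡 n)
      (TotalSpace.proj : CotangentBundle n M → M) ξ :=
      mdifferentiableAt_proj (E := fun x : M => CotangentSpace n x)
    have h1 : pairing (f • σ) = fun η : CotangentBundle n M => f η.proj • pairing σ η := by
      ext η; simp [pairing]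
    have h2 : mvfderiv (cotangentModel n) (fun η : CotangentBundle n M => f η.proj) ξ
        = mvfderiv (𝓡 n) f ξ.proj ∘L projDeriv ξ := by
      simp only [mvfderiv, projDeriv]
      have := mfderiv_comp (I' := 𝓡 n) ξ hf hp
      erw [this]
      rfl
    rw [h1, mvfderiv_fun_smul (a := fun η : CotangentBundle n M => f η.proj) (hf.comp ξ hp)
      (pairing_mdiff hσ), h2,
      cov.isCovariantDerivativeOn.leibniz hσ hf]
    ext V
    simp [pairing]
    ring
  add {σ σ'} hσ hσ' := by
    have h1 : pairing (σ + σ') = fun η : CotangentBundle n M => pairing σ η + pairing σ' η := by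
      ext η; simp [pairing]
    rw [h1, mvfderiv_fun_add (pairing_mdiff hσ) (pairing_mdiff hσ'),
      cov.isCovariantDerivativeOn.add hσ hσ']
    ext V
    simp
    ring

/-- `connector cov ξ z V` is the value at `z` of the vertical part of `V`. -/
def connector (cov : AffineConnection n M) (ξ : CotangentBundle n M) :
    TangentSpace (𝓡 n) ξ.proj →L[ℝ] TangentSpace (cotangentModel n) ξ →L[ℝ] ℝ :=
  TensorialAt.mkHom _ ξ.proj (connector_tensorial cov ξ)

/-- The vertical projection `v^∇ : T_ξ T*M → T*_x M`. -/
def verticalPart (cov : AffineConnection n M) (ξ : CotangentBundle n M) :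
    TangentSpace (cotangentModel n) ξ →L[ℝ] CotangentSpace n ξ.proj :=
  let B : EuclideanSpace ℝ (Fin n) →L[ℝ]
    (EuclideanSpace ℝ (Fin n) × (EuclideanSpace ℝ (Fin n) →L[ℝ] ℝ)) →L[ℝ] ℝ := connector cov ξ
  B.flip

theorem verticalPart_apply (cov : AffineConnection n M) (ξ : CotangentBundle n M)
    (V : TangentSpace (cotangentModel n) ξ) (z : TangentSpace (𝓡 n) ξ.proj) :
    verticalPart cov ξ V z = connector cov ξ z V := rfl

theorem SmoothField.mdiff {Z : Π x : M, TangentSpace (𝓡 n) x} (hZ : SmoothField Z) (x : M) :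
    MDifferentiableAt (𝓡 n) ((𝓡 n).prod 𝓘(ℝ, EuclideanSpace ℝ (Fin n)))
      (fun x => TotalSpace.mk' (EuclideanSpace ℝ (Fin n)) x (Z x)) x :=
  ContMDiffAt.mdifferentiableAt (ContMDiff.contMDiffAt hZ) (by simp)

theorem connector_apply (cov : AffineConnection n M) (ξ : CotangentBundle n M)
    {Z : Π x : M, TangentSpace (𝓡 n) x} (hZ : SmoothField Z)
    (V : TangentSpace (cotangentModel n) ξ) :
    connector cov ξ (Z ξ.proj) V =
      mvfderiv (cotangentModel n) (pairing Z) ξ V - ξ.2 (cov Z ξ.proj (projDeriv ξ V)) := by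
  have := TensorialAt.mkHom_apply (connector_tensorial cov ξ) (hZ.mdiff ξ.proj)
  exact congrArg (fun A : TangentSpace (cotangentModel n) ξ →L[ℝ] ℝ => A V) this

theorem projDeriv_verticalLift (ξ : CotangentBundle n M) (η : CotangentSpace n ξ.proj) :
    projDeriv ξ (verticalLift ξ η) = 0 := by
  have h1 : MDifferentiableAt (cotangentModel n) (𝓡 n)
      (TotalSpace.proj : CotangentBundle n M → M) ξ :=
      mdifferentiableAt_proj (E := fun x : M => CotangentSpace n x)
  let p₀ : EuclideanSpace ℝ (Fin n) →L[ℝ] ℝ := ξ.2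
  let ι : (EuclideanSpace ℝ (Fin n) →L[ℝ] ℝ) → CotangentBundle n M := fun p => ⟨ξ.proj, p⟩
  have h : mfderiv 𝓘(ℝ, EuclideanSpace ℝ (Fin n) →L[ℝ] ℝ) (𝓡 n)
      ((TotalSpace.proj : CotangentBundle n M → M) ∘ ι) p₀ = projDeriv ξ ∘L verticalLift ξ :=
    mfderiv_comp (I' := cotangentModel n) p₀ h1 (fibre_mdiff ξ.proj p₀)
  have h0 : mfderiv 𝓘(ℝ, EuclideanSpace ℝ (Fin n) →L[ℝ] ℝ) (𝓡 n)
      ((TotalSpace.proj : CotangentBundle n M → M) ∘ ι) p₀ = 0 :=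
    mfderiv_const (c := ξ.proj)
  exact (DFunLike.congr_fun (h.symm.trans h0) η)

theorem connector_verticalLift [T2Space M] (cov : AffineConnection n M) (ξ : CotangentBundle n M)
    (z : TangentSpace (𝓡 n) ξ.proj) (η : CotangentSpace n ξ.proj) :
    connector cov ξ z (verticalLift ξ η) = η z := by
  obtain ⟨Z, hZ, rfl⟩ := exists_smoothField z
  rw [connector_apply cov ξ hZ, projDeriv_verticalLift]
  let p₀ : EuclideanSpace ℝ (Fin n) →L[ℝ] ℝ := ξ.2
  let ι : (EuclideanSpace ℝ (Fin n) →L[ℝ] ℝ) → CotangentBundle n M := fun p => ⟨ξ.proj, p⟩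
  let ev : (EuclideanSpace ℝ (Fin n) →L[ℝ] ℝ) →L[ℝ] ℝ :=
    ContinuousLinearMap.apply ℝ ℝ (Z ξ.proj : EuclideanSpace ℝ (Fin n))
  have h : mfderiv 𝓘(ℝ, EuclideanSpace ℝ (Fin n) →L[ℝ] ℝ) 𝓘(ℝ, ℝ) (pairing Z ∘ ι) p₀
      = mfderiv (cotangentModel n) 𝓘(ℝ, ℝ) (pairing Z) ξ ∘L verticalLift ξ :=
    mfderiv_comp (I' := cotangentModel n) p₀ (pairing_mdiff (hZ.mdiff ξ.proj))
      (fibre_mdiff ξ.proj p₀)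
  have h0 : mfderiv 𝓘(ℝ, EuclideanSpace ℝ (Fin n) →L[ℝ] ℝ) 𝓘(ℝ, ℝ) (pairing Z ∘ ι) p₀ = ev :=
    ev.hasMFDerivAt.mfderiv
  rw [map_zero, map_zero, sub_zero]
  exact (DFunLike.congr_fun (h.symm.trans h0) η)

theorem SmoothForm.mdiff {s : Π x : M, CotangentSpace n x} (hs : SmoothForm s) (x : M) :
    MDifferentiableAt (𝓡 n) (cotangentModel n) (sectionMap s) x :=
  (hs x).mdifferentiableAt (by simp)

theorem projDeriv_section {s : Π x : M, CotangentSpace n x} (hs : SmoothForm s) (x : M)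
    (X : TangentSpace (𝓡 n) x) :
    projDeriv (sectionMap s x) (mfderiv (𝓡 n) (cotangentModel n) (sectionMap s) x X) = X := by
  have h1 : MDifferentiableAt (cotangentModel n) (𝓡 n)
      (TotalSpace.proj : CotangentBundle n M → M) (sectionMap s x) :=
      mdifferentiableAt_proj (E := fun x : M => CotangentSpace n x)
  have h := mfderiv_comp (I' := cotangentModel n) x
    (g := (TotalSpace.proj : CotangentBundle n M → M)) h1 (hs.mdiff x)
  have h0 : (TotalSpace.proj : CotangentBundle n M → M) ∘ sectionMap s = id := rfl
  rw [h0, mfderiv_id] at h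
  exact (DFunLike.congr_fun h X).symm

theorem connector_section (cov : AffineConnection n M) {s : Π x : M, CotangentSpace n x}
    (hs : SmoothForm s) {Z : Π x : M, TangentSpace (𝓡 n) x} (hZ : SmoothField Z)
    (x : M) (X : TangentSpace (𝓡 n) x) :
    connector cov (sectionMap s x) (Z x)
      (mfderiv (𝓡 n) (cotangentModel n) (sectionMap s) x X) = dualDerivative cov s Z x X := by
  refine (connector_apply cov (sectionMap s x) hZ _).trans ?_
  rw [projDeriv_section hs]
  have h := mfderiv_comp (I' := cotangentModel n) x
    (g := pairing Z) (pairing_mdiff (hZ.mdiff x)) (hs.mdiff x)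
  have h2 := DFunLike.congr_fun h X
  unfold dualDerivative
  congr 1
  exact h2.symm

theorem projDeriv_surjective [T2Space M] (ξ : CotangentBundle n M) :
    Function.Surjective (projDeriv ξ) := by
  obtain ⟨x, p⟩ := ξ
  intro X
  obtain ⟨s, hs, rfl⟩ := exists_smoothForm p
  exact ⟨_, projDeriv_section hs x X⟩

theorem ext_of_connector [T2Space M] (cov : AffineConnection n M) (ξ : CotangentBundle n M)
    {V : TangentSpace (cotangentModel n) ξ} (h1 : projDeriv ξ V = 0)
    (h2 : ∀ z, connector cov ξ z V = 0) : V = 0 := by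
  let A : (EuclideanSpace ℝ (Fin n) × (EuclideanSpace ℝ (Fin n) →L[ℝ] ℝ)) →ₗ[ℝ]
    EuclideanSpace ℝ (Fin n) := (projDeriv ξ).toLinearMap
  let B : (EuclideanSpace ℝ (Fin n) →L[ℝ] ℝ) →ₗ[ℝ]
    (EuclideanSpace ℝ (Fin n) × (EuclideanSpace ℝ (Fin n) →L[ℝ] ℝ)) :=
    (verticalLift ξ).toLinearMap
  have hB : Function.Injective B := by
    rw [injective_iff_map_eq_zero]
    intro η hη
    refine ContinuousLinearMap.ext fun z => ?_
    have h := connector_verticalLift cov ξ z η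
    have h' : verticalLift ξ η = 0 := hη
    exact (h.symm.trans (congrArg (connector cov ξ z) h')).trans
      (ContinuousLinearMap.map_zero (connector cov ξ z))
  have hA : LinearMap.range A = ⊤ := LinearMap.range_eq_top.2 (projDeriv_surjective ξ)
  have hle : LinearMap.range B ≤ LinearMap.ker A := by
    rintro _ ⟨η, rfl⟩
    exact projDeriv_verticalLift ξ η
  have hdim : Module.finrank ℝ (LinearMap.ker A) ≤ Module.finrank ℝ (LinearMap.range B) := by
    have e1 := LinearMap.finrank_range_add_finrank_ker A
    rw [hA, finrank_top, Module.finrank_prod] at e1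
    rw [LinearMap.finrank_range_of_inj hB]
    omega
  have heq := Submodule.eq_of_le_of_finrank_le hle hdim
  have hV : V ∈ LinearMap.ker A := h1
  rw [← heq] at hV
  obtain ⟨η, hη⟩ := hV
  have hη' : verticalLift ξ η = V := hη
  have h0 : (η : CotangentSpace n ξ.proj) = 0 := by
    refine ContinuousLinearMap.ext fun z => ?_
    have h := connector_verticalLift cov ξ z η
    exact (h.symm.trans (congrArg (connector cov ξ z) hη')).trans (h2 z)
  exact hη'.symm.trans ((congrArg (verticalLift ξ) h0).trans
    (ContinuousLinearMap.map_zero (verticalLift ξ)))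

theorem connector_of_mem [T2Space M] (cov : AffineConnection n M) (ξ : CotangentBundle n M)
    {V : TangentSpace (cotangentModel n) ξ} (hV : V ∈ horizontalSpace cov ξ)
    (z : TangentSpace (𝓡 n) ξ.proj) : connector cov ξ z V = 0 := by
  obtain ⟨x, p⟩ := ξ
  obtain ⟨s, X, hs, hp, hd, hV⟩ := hV
  change s x = p at hp
  subst hp
  obtain ⟨Z, hZ, rfl⟩ := exists_smoothField z
  have hV' : mfderiv (𝓡 n) (cotangentModel n) (sectionMap s) x X = V :=
    eq_of_heq (TotalSpace.mk.inj hV).2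
  subst hV'
  exact (connector_section cov hs hZ x X).trans (hd Z hZ)

theorem exists_horizontal [T2Space M] (cov : AffineConnection n M) (ξ : CotangentBundle n M)
    (X : TangentSpace (𝓡 n) ξ.proj) :
    ∃ V ∈ horizontalSpace cov ξ, projDeriv ξ V = X := by
  obtain ⟨x, p⟩ := ξ
  change TangentSpace (𝓡 n) x at X
  suffices h : ∃ s : Π x : M, CotangentSpace n x, SmoothForm s ∧ s x = p ∧
      ∀ Z : Π x : M, TangentSpace (𝓡 n) x, SmoothField Z → dualDerivative cov s Z x X = 0 by
    obtain ⟨s, hs, rfl, hd⟩ := h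
    exact ⟨mfderiv (𝓡 n) (cotangentModel n) (sectionMap s) x X,
      ⟨s, X, hs, rfl, hd, rfl⟩, projDeriv_section hs x X⟩
  obtain ⟨s, hs, rfl⟩ := exists_smoothForm p
  by_cases hX : X = 0
  · subst hX
    exact ⟨s, hs, rfl, fun Z _ => by simp [dualDerivative]⟩
  obtain ⟨g, hg, hgx, hgX⟩ := exists_function hX
  let η : CotangentSpace n x :=
    verticalPart cov (sectionMap s x)
      (mfderiv (𝓡 n) (cotangentModel n) (sectionMap s) x X)
  obtain ⟨σ, hσ, hση⟩ := exists_smoothForm η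
  refine ⟨s - g • σ, ?_, ?_, ?_⟩
  · exact ContMDiff.sub_section hs (ContMDiff.smul_section hg hσ)
  · simp [hgx]
  · intro Z hZ
    have hc := connector_section cov hs hZ x X
    have hη : σ x (Z x) = dualDerivative cov s Z x X := by
      rw [hση, ← hc]; exact verticalPart_apply cov (sectionMap s x) _ _
    have d1 : MDifferentiableAt (𝓡 n) 𝓘(ℝ, ℝ) (fun y => s y (Z y)) x :=
      (pairing_mdiff (ξ := sectionMap s x) (hZ.mdiff x)).comp x (hs.mdiff x)
    have d2 : MDifferentiableAt (𝓡 n) 𝓘(ℝ, ℝ) (fun y => σ y (Z y)) x :=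
      (pairing_mdiff (ξ := sectionMap σ x) (hZ.mdiff x)).comp x (hσ.mdiff x)
    have d3 : MDifferentiableAt (𝓡 n) 𝓘(ℝ, ℝ) g x := (hg x).mdifferentiableAt (by simp)
    have h0 : (fun y => (s - g • σ) y (Z y)) = fun y => s y (Z y) - g y • σ y (Z y) := by
      ext y; simp
    unfold dualDerivative at hη ⊢
    have d4 : MDifferentiableAt (𝓡 n) 𝓘(ℝ, ℝ) (fun y => g y • σ y (Z y)) x := d3.smul d2
    rw [h0, mvfderiv_fun_sub d1 d4, mvfderiv_fun_smul d3 d2]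
    simp [hgx, hgX, hη]

theorem mem_horizontalSpace [T2Space M] (cov : AffineConnection n M) (ξ : CotangentBundle n M)
    (V : TangentSpace (cotangentModel n) ξ) :
    V ∈ horizontalSpace cov ξ ↔ ∀ z, connector cov ξ z V = 0 := by
  refine ⟨connector_of_mem cov ξ, fun h => ?_⟩
  obtain ⟨W, hW, hWV⟩ := exists_horizontal cov ξ (projDeriv ξ V)
  have h0 : V - W = 0 := ext_of_connector cov ξ (by
    rw [ContinuousLinearMap.map_sub, hWV, sub_self])
    (fun z => by
      rw [ContinuousLinearMap.map_sub, h, connector_of_mem cov ξ hW, sub_zero])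
  rwa [sub_eq_zero.1 h0]

/-- `A` is the product structure `J ⊕ ᵗJ` in the splitting `T_ξ T*M = H_ξ ⊕ T*_x M`. -/
structure IsProductLift (J : Π x : M, TangentSpace (𝓡 n) x →L[ℝ] TangentSpace (𝓡 n) x)
    (cov : AffineConnection n M) (ξ : CotangentBundle n M)
    (A : TangentSpace (cotangentModel n) ξ →L[ℝ] TangentSpace (cotangentModel n) ξ) : Prop where
  mem_horizontal : ∀ V ∈ horizontalSpace cov ξ, A V ∈ horizontalSpace cov ξ
  projDeriv_horizontal : ∀ V ∈ horizontalSpace cov ξ,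
    projDeriv ξ (A V) = J ξ.proj (projDeriv ξ V)
  vertical : ∀ η : CotangentSpace n ξ.proj,
    A (verticalLift ξ η) = verticalLift ξ (η ∘L J ξ.proj)

theorem existsUnique_isProductLift [T2Space M]
    (J : Π x : M, TangentSpace (𝓡 n) x →L[ℝ] TangentSpace (𝓡 n) x)
    (cov : AffineConnection n M) (ξ : CotangentBundle n M) :
    ∃! A, IsProductLift J cov ξ A := by
  let J₀ : EuclideanSpace ℝ (Fin n) →L[ℝ] EuclideanSpace ℝ (Fin n) := J ξ.proj
  obtain ⟨A, ⟨h1, h2, h3⟩, hA⟩ := existsUnique_product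
    (T := EuclideanSpace ℝ (Fin n) × (EuclideanSpace ℝ (Fin n) →L[ℝ] ℝ))
    (X := EuclideanSpace ℝ (Fin n)) (C := EuclideanSpace ℝ (Fin n) →L[ℝ] ℝ)
    (projDeriv ξ) (verticalPart cov ξ) (verticalLift ξ) (horizontalSpace cov ξ)
    J₀ ((ContinuousLinearMap.compL ℝ _ _ ℝ).flip J₀)
    (projDeriv_verticalLift ξ)
    (fun η => ContinuousLinearMap.ext fun z => connector_verticalLift cov ξ z η)
    (fun V => (mem_horizontalSpace cov ξ V).trans
      ⟨fun h => ContinuousLinearMap.ext h, fun h z => DFunLike.congr_fun h z⟩)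
    (exists_horizontal cov ξ)
    (fun V h1 h2 => ext_of_connector cov ξ h1 (fun z => DFunLike.congr_fun h2 z))
  exact ⟨A, ⟨h1, h2, h3⟩, fun B hB => hA B ⟨hB.1, hB.2, hB.3⟩⟩

end Defs

/-! ### Almost complex structures, holomorphic maps and lifts -/

/-- An almost complex structure: a smooth field `J` of endomorphisms of `TM` with `J² = -id`. -/
structure AlmostComplexStructure (n : ℕ) (M : Type*) [TopologicalSpace M]
    [ChartedSpace (EuclideanSpace ℝ (Fin n)) M] [IsManifold (𝓡 n) ∞ M] where
  /-- The endomorphism `J(x)` of `T_x M`. -/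
  toFun : Π x : M, TangentSpace (𝓡 n) x →L[ℝ] TangentSpace (𝓡 n) x
  smooth : ContMDiff (𝓡 n)
    ((𝓡 n).prod 𝓘(ℝ, EuclideanSpace ℝ (Fin n) →L[ℝ] EuclideanSpace ℝ (Fin n))) ∞
    (fun x => TotalSpace.mk' (EuclideanSpace ℝ (Fin n) →L[ℝ] EuclideanSpace ℝ (Fin n))
      (E := fun x : M => TangentSpace (𝓡 n) x →L[ℝ] TangentSpace (𝓡 n) x) x (toFun x))
  sq_eq_neg_id : ∀ (x : M) (X : TangentSpace (𝓡 n) x), toFun x (toFun x X) = -X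

/-- A smooth map `f : N → N'` is `(A, A')`-holomorphic if `A'(f(x)) ∘ d_x f = d_x f ∘ A(x)` for
all `x`, where `A`, `A'` are fields of endomorphisms of the tangent spaces. -/
def IsHolomorphic {E E' H H' N N' : Type*} [NormedAddCommGroup E] [NormedSpace ℝ E]
    [TopologicalSpace H] (I : ModelWithCorners ℝ E H) [TopologicalSpace N] [ChartedSpace H N]
    [NormedAddCommGroup E'] [NormedSpace ℝ E'] [TopologicalSpace H']
    (I' : ModelWithCorners ℝ E' H') [TopologicalSpace N'] [ChartedSpace H' N']
    (A : Π x : N, TangentSpace I x →L[ℝ] TangentSpace I x)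
    (A' : Π y : N', TangentSpace I' y →L[ℝ] TangentSpace I' y) (f : N → N') : Prop :=
  ContMDiff I I' ∞ f ∧ ∀ x : N, A' (f x) ∘L mfderiv I I' f x = mfderiv I I' f x ∘L A x

section Main

variable {n : ℕ} {M : Type*} [TopologicalSpace M]
    [ChartedSpace (EuclideanSpace ℝ (Fin n)) M] [IsManifold (𝓡 n) ∞ M]

/-- The generalized horizontal lift `J^{G,∇}`: at `ξ ∈ T*M` it is the unique endomorphism of
`T_ξ T*M` that equals `J ⊕ ᵗJ` in the splitting `T_ξ T*M = H_ξ ⊕ T*_x M`. -/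
def generalizedHorizontalLift [T2Space M] (J : AlmostComplexStructure n M)
    (cov : AffineConnection n M) (ξ : CotangentBundle n M) :
    TangentSpace (cotangentModel n) ξ →L[ℝ] TangentSpace (cotangentModel n) ξ :=
  (existsUnique_isProductLift J.toFun cov ξ).choose

theorem generalizedHorizontalLift_spec [T2Space M] (J : AlmostComplexStructure n M)
    (cov : AffineConnection n M) (ξ : CotangentBundle n M) :
    IsProductLift J.toFun cov ξ (generalizedHorizontalLift J cov ξ) :=
  (existsUnique_isProductLift J.toFun cov ξ).choose_spec.1

theorem AlmostComplexStructure.mdiff_apply (J : AlmostComplexStructure n M)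
    {Z : Π x : M, TangentSpace (𝓡 n) x} {x : M}
    (hZ : MDifferentiableAt (𝓡 n) ((𝓡 n).prod 𝓘(ℝ, EuclideanSpace ℝ (Fin n)))
      (fun x => TotalSpace.mk' (EuclideanSpace ℝ (Fin n)) x (Z x)) x) :
    MDifferentiableAt (𝓡 n) ((𝓡 n).prod 𝓘(ℝ, EuclideanSpace ℝ (Fin n)))
      (fun x => TotalSpace.mk' (EuclideanSpace ℝ (Fin n)) x (J.toFun x (Z x))) x :=
  MDifferentiableAt.clm_bundle_apply (IB := 𝓡 n) (F₁ := EuclideanSpace ℝ (Fin n))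
    (F₂ := EuclideanSpace ℝ (Fin n)) (E₁ := (TangentSpace (𝓡 n) : M → Type _))
    (E₂ := (TangentSpace (𝓡 n) : M → Type _)) (b := fun x : M => x) (ϕ := J.toFun) (v := Z)
    (ContMDiffAt.mdifferentiableAt (ContMDiff.contMDiffAt J.smooth) (by simp)) hZ

theorem nablaJ_tensorial (J : AlmostComplexStructure n M) (cov : AffineConnection n M) (x : M) :
    TensorialAt (𝓡 n) (EuclideanSpace ℝ (Fin n))
      (fun Y : Π x : M, TangentSpace (𝓡 n) x =>
        cov (fun y => J.toFun y (Y y)) x - J.toFun x ∘L cov Y x) x where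
  smul {f σ} hf hσ := by
    have h1 : (fun y => J.toFun y ((f • σ) y)) = f • fun y => J.toFun y (σ y) := by
      ext1 y
      exact (J.toFun y).map_smul (f y) (σ y)
    rw [h1, cov.isCovariantDerivativeOn.leibniz hσ hf,
      cov.isCovariantDerivativeOn.leibniz (J.mdiff_apply hσ) hf]
    refine ContinuousLinearMap.ext fun V => ?_
    simp [smul_sub]
  add {σ σ'} hσ hσ' := by
    have h1 : (fun y => J.toFun y ((σ + σ') y)) =
        (fun y => J.toFun y (σ y)) + fun y => J.toFun y (σ' y) := by
      ext1 y
      exact (J.toFun y).map_add (σ y) (σ' y)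
    rw [h1, cov.isCovariantDerivativeOn.add hσ hσ',
      cov.isCovariantDerivativeOn.add (J.mdiff_apply hσ) (J.mdiff_apply hσ')]
    refine ContinuousLinearMap.ext fun V => ?_
    simp
    abel

/-- The tensor `(∇J)(X, Y) = ∇_X (JY) - J ∇_X Y`. -/
def nablaJ (J : AlmostComplexStructure n M) (cov : AffineConnection n M) (x : M)
    (X Y : TangentSpace (𝓡 n) x) : TangentSpace (𝓡 n) x :=
  TensorialAt.mkHom _ x (nablaJ_tensorial J cov x) Y X

/-- `nablaJ` computes the difference `∇_X (JY) - J ∇_X Y` on vector fields. -/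
theorem nablaJ_apply (J : AlmostComplexStructure n M) (cov : AffineConnection n M)
    {Y : Π x : M, TangentSpace (𝓡 n) x} (hY : SmoothField Y) (x : M)
    (X : TangentSpace (𝓡 n) x) :
    nablaJ J cov x X (Y x) = cov (fun y => J.toFun y (Y y)) x X - J.toFun x (cov Y x X) :=
  DFunLike.congr_fun (TensorialAt.mkHom_apply (nablaJ_tensorial J cov x) (hY.mdiff x)) X

/-- The tensor `S(X, Y) = -(∇J)(X, Y) + (∇J)(Y, X) + T(JX, Y) - J T(X, Y)`, where `T` is the
torsion of `∇`. -/
def tensorS (J : AlmostComplexStructure n M) (cov : AffineConnection n M) (x : M)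
    (X Y : TangentSpace (𝓡 n) x) : TangentSpace (𝓡 n) x :=
  -nablaJ J cov x X Y + nablaJ J cov x Y X + cov.torsion x (J.toFun x X) Y
    - J.toFun x (cov.torsion x X Y)

variable {n' : ℕ} {M' : Type*} [TopologicalSpace M']
    [ChartedSpace (EuclideanSpace ℝ (Fin n')) M'] [IsManifold (𝓡 n') ∞ M']

/-- The differential `d_x f` of a diffeomorphism, as an isomorphism `T_x M ≃ T_{f(x)} M'`. -/
def diffeoDeriv (f : M ≃ₘ^∞⟮𝓡 n, 𝓡 n'⟯ M') (x : M) :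
    TangentSpace (𝓡 n) x ≃L[ℝ] TangentSpace (𝓡 n') (f x) :=
  f.mfderivToContinuousLinearEquiv (by simp) x

/-- The lift `f̃ = (f, ᵗ(df)⁻¹)` of a diffeomorphism to the cotangent bundles. -/
def cotangentLift (f : M ≃ₘ^∞⟮𝓡 n, 𝓡 n'⟯ M') (ξ : CotangentBundle n M) : CotangentBundle n' M' :=
  ⟨f ξ.proj, ξ.2 ∘L ((diffeoDeriv f ξ.proj).symm :
    TangentSpace (𝓡 n') (f ξ.proj) →L[ℝ] TangentSpace (𝓡 n) ξ.proj)⟩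

/-- The direct image of a tensor field `S` of type `(1,2)` under a diffeomorphism `f`, at the point
`f(x)` (every point of `M'` is of this form for exactly one `x`):
`(f_* S)(X, Y) = d_x f (S((d_x f)⁻¹ X, (d_x f)⁻¹ Y))`. -/
def pushforwardAt (f : M ≃ₘ^∞⟮𝓡 n, 𝓡 n'⟯ M')
    (S : Π x : M, TangentSpace (𝓡 n) x → TangentSpace (𝓡 n) x → TangentSpace (𝓡 n) x) (x : M)
    (X Y : TangentSpace (𝓡 n') (f x)) : TangentSpace (𝓡 n') (f x) :=
  diffeoDeriv f x (S x ((diffeoDeriv f x).symm X) ((diffeoDeriv f x).symm Y))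

end Main

end CotangentLift

end

/-!
The differential `dπ` and the connector `K : T(T*M) → T*M`, the projection onto the vertical part,
identify `T_ξ T*M` with `T_x M ⊕ T*_x M`, so the lift `A = J^{G,∇}` is determined by
`dπ (A V) = J (dπ V)` and `K_z (A V) = K_{Jz} V`. The first identity is part 1, and part 2 holds
because the zero section is parallel, hence has horizontal differential.

Let `D = ∇ - ∇'` be the difference tensor of two connections on `M`, with `D(z) X` the value of
`∇_X Z - ∇'_X Z` where `Z = z`. Then `K'_z V = K_z V + ξ (D(z) (dπ V))`. On the other hand
`S(X, Y) = ∇_{JX} Y - ∇_X (JY) - [JX, Y] + J[X, Y]`, whose brackets do not involve `∇`, so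
`S(X, z) - S'(X, z) = D(z) (JX) - D(Jz) X`. Hence the lifts `A`, `A'` satisfy
`K_z (A V - A' V) = ξ (S(dπ V, z) - S'(dπ V, z))`: they agree if and only if `S = S'`.

If `f` is holomorphic, then `f̃` carries the lift for `f^*∇₂` to the lift for `∇₂`, and `f_*`
carries the tensor `S` of `f^*∇₂` to `S₂`. Thus part 3 is the comparison of `∇₁` with `f^*∇₂`
on `M₁`.
-/

namespace CotangentLift

section Sections

variable {n : ℕ} {M : Type*} [TopologicalSpace M]
    [ChartedSpace (EuclideanSpace ℝ (Fin n)) M] [IsManifold (𝓡 n) ∞ M]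

theorem smoothForm_zero : SmoothForm (0 : Π x : M, CotangentSpace n x) :=
  contMDiff_zeroSection ℝ (fun x : M => CotangentSpace n x)

theorem mfderiv_zeroSection_mem_horizontalSpace (cov : AffineConnection n M) (x : M)
    (X : TangentSpace (𝓡 n) x) :
    mfderiv (𝓡 n) (cotangentModel n) (sectionMap 0) x X ∈ horizontalSpace cov ⟨x, 0⟩ := by
  refine ⟨0, X, smoothForm_zero, rfl, fun Z _ => ?_, rfl⟩
  have h : mvfderiv (𝓡 n) (fun y => (0 : CotangentSpace n y) (Z y)) x X = 0 :=
    DFunLike.congr_fun (mfderiv_const (c := (0 : ℝ))) X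
  exact (congrArg₂ (· - ·) h rfl).trans (sub_zero 0)

end Sections

section Splitting

variable {n : ℕ} {M : Type*} [TopologicalSpace M]
    [ChartedSpace (EuclideanSpace ℝ (Fin n)) M] [IsManifold (𝓡 n) ∞ M] [T2Space M]
    {cov : AffineConnection n M} {ξ : CotangentBundle n M}
    {J : Π x : M, TangentSpace (𝓡 n) x →L[ℝ] TangentSpace (𝓡 n) x}

theorem eq_of_connector (cov : AffineConnection n M) {V W : TangentSpace (cotangentModel n) ξ}
    (hproj : projDeriv ξ V = projDeriv ξ W)
    (hconn : ∀ z, connector cov ξ z V = connector cov ξ z W) : V = W :=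
  sub_eq_zero.1 (ext_of_connector cov ξ
    (by rw [ContinuousLinearMap.map_sub, hproj, sub_self])
    fun z => by rw [ContinuousLinearMap.map_sub, hconn, sub_self])

theorem eq_of_mem_horizontalSpace {H H' : TangentSpace (cotangentModel n) ξ}
    (hH : H ∈ horizontalSpace cov ξ) (hH' : H' ∈ horizontalSpace cov ξ)
    (h : projDeriv ξ H = projDeriv ξ H') : H = H' :=
  eq_of_connector cov h fun z =>
    (connector_of_mem cov ξ hH z).trans (connector_of_mem cov ξ hH' z).symm

theorem exists_horizontal_add_verticalLift (cov : AffineConnection n M)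
    (V : TangentSpace (cotangentModel n) ξ) :
    ∃ H ∈ horizontalSpace cov ξ, projDeriv ξ H = projDeriv ξ V ∧
      V = H + verticalLift ξ (verticalPart cov ξ V) := by
  obtain ⟨H, hH, hHV⟩ := exists_horizontal cov ξ (projDeriv ξ V)
  refine ⟨H, hH, hHV, eq_of_connector cov ?_ fun z => ?_⟩
  · rw [ContinuousLinearMap.map_add, projDeriv_verticalLift, hHV, add_zero]
  · rw [ContinuousLinearMap.map_add, connector_verticalLift, connector_of_mem cov ξ hH, zero_add,
      verticalPart_apply]

theorem IsProductLift.exists_apply_eq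
    {A : TangentSpace (cotangentModel n) ξ →L[ℝ] TangentSpace (cotangentModel n) ξ}
    (hA : IsProductLift J cov ξ A) (V : TangentSpace (cotangentModel n) ξ) :
    ∃ H ∈ horizontalSpace cov ξ, projDeriv ξ H = J ξ.proj (projDeriv ξ V) ∧
      A V = H + verticalLift ξ (verticalPart cov ξ V ∘L J ξ.proj) := by
  obtain ⟨H, hH, hHV, hV⟩ := exists_horizontal_add_verticalLift cov V
  refine ⟨A H, hA.mem_horizontal H hH, by rw [hA.projDeriv_horizontal H hH, hHV], ?_⟩
  conv_lhs => rw [hV]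
  rw [ContinuousLinearMap.map_add, hA.vertical]

theorem IsProductLift.projDeriv_apply
    {A : TangentSpace (cotangentModel n) ξ →L[ℝ] TangentSpace (cotangentModel n) ξ}
    (hA : IsProductLift J cov ξ A) (V : TangentSpace (cotangentModel n) ξ) :
    projDeriv ξ (A V) = J ξ.proj (projDeriv ξ V) := by
  obtain ⟨H, -, hHV, hAV⟩ := hA.exists_apply_eq V
  rw [hAV, ContinuousLinearMap.map_add, projDeriv_verticalLift, add_zero, hHV]

theorem IsProductLift.connector_apply
    {A : TangentSpace (cotangentModel n) ξ →L[ℝ] TangentSpace (cotangentModel n) ξ}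
    (hA : IsProductLift J cov ξ A) (z : TangentSpace (𝓡 n) ξ.proj)
    (V : TangentSpace (cotangentModel n) ξ) :
    connector cov ξ z (A V) = connector cov ξ (J ξ.proj z) V := by
  obtain ⟨H, hH, -, hAV⟩ := hA.exists_apply_eq V
  rw [hAV, ContinuousLinearMap.map_add, connector_verticalLift, connector_of_mem cov ξ hH,
    zero_add]
  exact verticalPart_apply cov ξ V (J ξ.proj z)

/-- The endomorphism `J ⊕ ᵗJ` of `T_ξ T*M` for an arbitrary, possibly discontinuous, field `J` of
endomorphisms of `TM`; for an almost complex structure it is `generalizedHorizontalLift`. -/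
noncomputable def productLift (J : Π x : M, TangentSpace (𝓡 n) x →L[ℝ] TangentSpace (𝓡 n) x)
    (cov : AffineConnection n M) (ξ : CotangentBundle n M) :
    TangentSpace (cotangentModel n) ξ →L[ℝ] TangentSpace (cotangentModel n) ξ :=
  (existsUnique_isProductLift J cov ξ).choose

theorem isProductLift_productLift
    (J : Π x : M, TangentSpace (𝓡 n) x →L[ℝ] TangentSpace (𝓡 n) x)
    (cov : AffineConnection n M) (ξ : CotangentBundle n M) :
    IsProductLift J cov ξ (productLift J cov ξ) :=
  (existsUnique_isProductLift J cov ξ).choose_spec.1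

theorem isHolomorphic_proj (J : Π x : M, TangentSpace (𝓡 n) x →L[ℝ] TangentSpace (𝓡 n) x)
    (cov : AffineConnection n M) :
    IsHolomorphic (cotangentModel n) (𝓡 n) (productLift J cov) J
      (fun ξ : CotangentBundle n M => ξ.proj) :=
  ⟨contMDiff_proj (fun x : M => CotangentSpace n x), fun ξ => ContinuousLinearMap.ext fun V =>
    ((isProductLift_productLift J cov ξ).projDeriv_apply V).symm⟩

theorem isHolomorphic_zeroSection
    (J : Π x : M, TangentSpace (𝓡 n) x →L[ℝ] TangentSpace (𝓡 n) x) (cov : AffineConnection n M) :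
    IsHolomorphic (𝓡 n) (cotangentModel n) J (productLift J cov)
      (fun x : M => (⟨x, 0⟩ : CotangentBundle n M)) := by
  refine ⟨smoothForm_zero, fun x => ContinuousLinearMap.ext fun X => ?_⟩
  have hA := isProductLift_productLift J cov ⟨x, 0⟩
  have hX := mfderiv_zeroSection_mem_horizontalSpace cov x X
  refine eq_of_mem_horizontalSpace (hA.mem_horizontal _ hX)
    (mfderiv_zeroSection_mem_horizontalSpace cov x (J x X)) ?_
  exact ((hA.projDeriv_apply _).trans
    (congrArg (J x) (projDeriv_section smoothForm_zero x X))).trans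
      (projDeriv_section smoothForm_zero x (J x X)).symm

end Splitting

/-- Differentiability at `x` of a vector field. -/
abbrev DifferentiableFieldAt {n : ℕ} {M : Type*} [TopologicalSpace M]
    [ChartedSpace (EuclideanSpace ℝ (Fin n)) M] [IsManifold (𝓡 n) ∞ M]
    (Z : Π x : M, TangentSpace (𝓡 n) x) (x : M) : Prop :=
  MDifferentiableAt (𝓡 n) ((𝓡 n).prod 𝓘(ℝ, EuclideanSpace ℝ (Fin n)))
    (fun x => TotalSpace.mk' (EuclideanSpace ℝ (Fin n)) x (Z x)) x

/-- A differentiable field of endomorphisms of the tangent spaces of `M`: what is left of an almost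
complex structure `J` when `J² = -id` is dropped. It is the natural input of `∇J` and of `S`. -/
structure DifferentiableEndomorphism (n : ℕ) (M : Type*) [TopologicalSpace M]
    [ChartedSpace (EuclideanSpace ℝ (Fin n)) M] [IsManifold (𝓡 n) ∞ M] where
  toFun : Π x : M, TangentSpace (𝓡 n) x →L[ℝ] TangentSpace (𝓡 n) x
  mdifferentiable : MDifferentiable (𝓡 n)
    ((𝓡 n).prod 𝓘(ℝ, EuclideanSpace ℝ (Fin n) →L[ℝ] EuclideanSpace ℝ (Fin n)))
    (fun x => TotalSpace.mk' (EuclideanSpace ℝ (Fin n) →L[ℝ] EuclideanSpace ℝ (Fin n))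
      (E := fun x : M => TangentSpace (𝓡 n) x →L[ℝ] TangentSpace (𝓡 n) x) x (toFun x))

section Tensor

variable {n : ℕ} {M : Type*} [TopologicalSpace M]
    [ChartedSpace (EuclideanSpace ℝ (Fin n)) M] [IsManifold (𝓡 n) ∞ M]

/-- The field of endomorphisms underlying an almost complex structure. -/
def AlmostComplexStructure.toDifferentiableEndomorphism (J : AlmostComplexStructure n M) :
    DifferentiableEndomorphism n M where
  toFun := J.toFun
  mdifferentiable := J.smooth.mdifferentiable (by simp)

namespace DifferentiableEndomorphism

theorem differentiableFieldAt_apply (J : DifferentiableEndomorphism n M)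
    {Z : Π x : M, TangentSpace (𝓡 n) x} {x : M} (hZ : DifferentiableFieldAt Z x) :
    DifferentiableFieldAt (fun y => J.toFun y (Z y)) x :=
  MDifferentiableAt.clm_bundle_apply (IB := 𝓡 n) (F₁ := EuclideanSpace ℝ (Fin n))
    (F₂ := EuclideanSpace ℝ (Fin n)) (E₁ := (TangentSpace (𝓡 n) : M → Type _))
    (E₂ := (TangentSpace (𝓡 n) : M → Type _)) (b := fun x : M => x) (ϕ := J.toFun) (v := Z)
    (J.mdifferentiable x) hZ

theorem nabla_tensorial (J : DifferentiableEndomorphism n M) (cov : AffineConnection n M)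
    (x : M) :
    TensorialAt (𝓡 n) (EuclideanSpace ℝ (Fin n))
      (fun Y : Π x : M, TangentSpace (𝓡 n) x =>
        cov (fun y => J.toFun y (Y y)) x - J.toFun x ∘L cov Y x) x where
  smul {f σ} hf hσ := by
    have hJ : (fun y => J.toFun y ((f • σ) y)) = f • fun y => J.toFun y (σ y) :=
      funext fun y => (J.toFun y).map_smul (f y) (σ y)
    rw [hJ, cov.isCovariantDerivativeOn.leibniz hσ hf,
      cov.isCovariantDerivativeOn.leibniz (J.differentiableFieldAt_apply hσ) hf]
    refine ContinuousLinearMap.ext fun V => ?_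
    simp [smul_sub]
  add {σ σ'} hσ hσ' := by
    have hJ : (fun y => J.toFun y ((σ + σ') y)) =
        (fun y => J.toFun y (σ y)) + fun y => J.toFun y (σ' y) :=
      funext fun y => (J.toFun y).map_add (σ y) (σ' y)
    rw [hJ, cov.isCovariantDerivativeOn.add hσ hσ',
      cov.isCovariantDerivativeOn.add (J.differentiableFieldAt_apply hσ)
        (J.differentiableFieldAt_apply hσ')]
    refine ContinuousLinearMap.ext fun V => ?_
    simp
    abel

/-- The tensor `(∇J)(X, Y) = ∇_X (JY) - J ∇_X Y` of a differentiable field `J` of endomorphisms. -/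
noncomputable def nabla (J : DifferentiableEndomorphism n M) (cov : AffineConnection n M) (x : M)
    (X Y : TangentSpace (𝓡 n) x) : TangentSpace (𝓡 n) x :=
  TensorialAt.mkHom _ x (J.nabla_tensorial cov x) Y X

theorem nabla_apply (J : DifferentiableEndomorphism n M) (cov : AffineConnection n M)
    {Y : Π x : M, TangentSpace (𝓡 n) x} {x : M} (hY : DifferentiableFieldAt Y x)
    (X : TangentSpace (𝓡 n) x) :
    J.nabla cov x X (Y x) = cov (fun y => J.toFun y (Y y)) x X - J.toFun x (cov Y x X) :=
  DFunLike.congr_fun (TensorialAt.mkHom_apply (J.nabla_tensorial cov x) hY) X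

/-- The tensor `S(X, Y) = -(∇J)(X, Y) + (∇J)(Y, X) + T(JX, Y) - J T(X, Y)` of a differentiable
field `J` of endomorphisms, where `T` is the torsion of `∇`. -/
noncomputable def tensorS (J : DifferentiableEndomorphism n M) (cov : AffineConnection n M)
    (x : M) (X Y : TangentSpace (𝓡 n) x) : TangentSpace (𝓡 n) x :=
  -J.nabla cov x X Y + J.nabla cov x Y X + cov.torsion x (J.toFun x X) Y
    - J.toFun x (cov.torsion x X Y)

theorem tensorS_apply (J : DifferentiableEndomorphism n M) (cov : AffineConnection n M)
    {X Y : Π x : M, TangentSpace (𝓡 n) x} {x : M} (hX : DifferentiableFieldAt X x)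
    (hY : DifferentiableFieldAt Y x) :
    J.tensorS cov x (X x) (Y x) =
      cov Y x (J.toFun x (X x)) - cov (fun y => J.toFun y (Y y)) x (X x)
        - VectorField.mlieBracket (𝓡 n) (fun y => J.toFun y (X y)) Y x
        + J.toFun x (VectorField.mlieBracket (𝓡 n) X Y x) := by
  rw [tensorS, J.nabla_apply cov hY, J.nabla_apply cov hX, cov.torsion_apply hX hY,
    cov.torsion_apply (J.differentiableFieldAt_apply hX) hY, map_sub, map_sub]
  abel

end DifferentiableEndomorphism

end Tensor

section Comparison

variable {n : ℕ} {M : Type*} [TopologicalSpace M]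
    [ChartedSpace (EuclideanSpace ℝ (Fin n)) M] [IsManifold (𝓡 n) ∞ M]
    (J : DifferentiableEndomorphism n M) (cov cov' : AffineConnection n M)

theorem difference_apply {Z : Π x : M, TangentSpace (𝓡 n) x} {x : M}
    (hZ : DifferentiableFieldAt Z x) (X : TangentSpace (𝓡 n) x) :
    cov.difference cov' x (Z x) X = cov Z x X - cov' Z x X :=
  DFunLike.congr_fun (cov.isCovariantDerivativeOn.difference_apply cov'.isCovariantDerivativeOn
    (Set.mem_univ x) hZ) X

variable [T2Space M]

theorem connector_eq_add_difference (ξ : CotangentBundle n M) (z : TangentSpace (𝓡 n) ξ.proj)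
    (V : TangentSpace (cotangentModel n) ξ) :
    connector cov' ξ z V =
      connector cov ξ z V + ξ.2 (cov.difference cov' ξ.proj z (projDeriv ξ V)) := by
  obtain ⟨Z, hZ, rfl⟩ := exists_smoothField z
  rw [connector_apply cov ξ hZ, connector_apply cov' ξ hZ,
    difference_apply cov cov' (hZ.mdiff ξ.proj), map_sub]
  ring

theorem tensorS_sub_tensorS {x : M} (X Y : TangentSpace (𝓡 n) x) :
    J.tensorS cov x X Y - J.tensorS cov' x X Y =
      cov.difference cov' x Y (J.toFun x X) - cov.difference cov' x (J.toFun x Y) X := by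
  obtain ⟨X, hX, rfl⟩ := exists_smoothField X
  obtain ⟨Y, hY, rfl⟩ := exists_smoothField Y
  rw [J.tensorS_apply cov (hX.mdiff x) (hY.mdiff x), J.tensorS_apply cov' (hX.mdiff x) (hY.mdiff x),
    difference_apply cov cov' (hY.mdiff x),
    difference_apply cov cov' (J.differentiableFieldAt_apply (hY.mdiff x))]
  abel

theorem connector_productLift_sub {ξ : CotangentBundle n M}
    {A A' : TangentSpace (cotangentModel n) ξ →L[ℝ] TangentSpace (cotangentModel n) ξ}
    (hA : IsProductLift J.toFun cov ξ A) (hA' : IsProductLift J.toFun cov' ξ A')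
    (z : TangentSpace (𝓡 n) ξ.proj) (V : TangentSpace (cotangentModel n) ξ) :
    connector cov ξ z (A V - A' V) =
      ξ.2 (J.tensorS cov ξ.proj (projDeriv ξ V) z - J.tensorS cov' ξ.proj (projDeriv ξ V) z) := by
  have hz := connector_eq_add_difference cov cov' ξ z (A' V)
  have hJz := connector_eq_add_difference cov cov' ξ (J.toFun ξ.proj z) V
  rw [hA'.connector_apply, hA'.projDeriv_apply] at hz
  rw [tensorS_sub_tensorS, ContinuousLinearMap.map_sub, map_sub, hA.connector_apply]
  linarith

theorem productLift_eq_iff_tensorS_eq :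
    productLift J.toFun cov = productLift J.toFun cov' ↔ J.tensorS cov = J.tensorS cov' := by
  have key (ξ : CotangentBundle n M) := connector_productLift_sub J cov cov'
    (isProductLift_productLift J.toFun cov ξ) (isProductLift_productLift J.toFun cov' ξ)
  constructor
  · intro h
    funext x X z
    refine sub_eq_zero.1 (not_ne_iff.1 fun hne => ?_)
    obtain ⟨p, hp⟩ : ∃ p : CotangentSpace n x, p _ ≠ 0 :=
      SeparatingDual.exists_ne_zero (R := ℝ) (V := EuclideanSpace ℝ (Fin n)) hne
    obtain ⟨V, rfl⟩ := projDeriv_surjective (⟨x, p⟩ : CotangentBundle n M) X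
    refine hp ((key ⟨x, p⟩ z V).symm.trans ?_)
    rw [h, sub_self, ContinuousLinearMap.map_zero]
  · intro h
    funext ξ
    refine ContinuousLinearMap.ext fun V => sub_eq_zero.1 (ext_of_connector cov _ ?_ fun z => ?_)
    · rw [ContinuousLinearMap.map_sub, (isProductLift_productLift _ _ _).projDeriv_apply,
        (isProductLift_productLift _ _ _).projDeriv_apply, sub_self]
    · exact (key ξ z V).trans (by rw [h, sub_self, map_zero])

end Comparison

section Diffeo

variable {n : ℕ} {M : Type*} [TopologicalSpace M]
    [ChartedSpace (EuclideanSpace ℝ (Fin n)) M]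
    {n' : ℕ} {M' : Type*} [TopologicalSpace M']
    [ChartedSpace (EuclideanSpace ℝ (Fin n')) M']
    (f : M ≃ₘ^∞⟮𝓡 n, 𝓡 n'⟯ M')

theorem mdifferentiableAt_diffeo (x : M) : MDifferentiableAt (𝓡 n) (𝓡 n') f x :=
  f.contMDiff.mdifferentiableAt (by simp)

theorem mdifferentiableAt_comp_symm {g : M → ℝ} {x : M}
    (hg : MDifferentiableAt (𝓡 n) 𝓘(ℝ, ℝ) g x) :
    MDifferentiableAt (𝓡 n') 𝓘(ℝ, ℝ) (g ∘ f.symm) (f x) :=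
  MDifferentiableAt.comp (I' := 𝓡 n) (f x) (by rwa [f.symm_apply_apply])
    (mdifferentiableAt_diffeo f.symm (f x))

theorem mvfderiv_comp_symm_diffeoDeriv {g : M → ℝ} {x : M}
    (hg : MDifferentiableAt (𝓡 n) 𝓘(ℝ, ℝ) g x) (X : TangentSpace (𝓡 n) x) :
    mvfderiv (𝓡 n') (g ∘ f.symm) (f x) (diffeoDeriv f x X) = mvfderiv (𝓡 n) g x X := by
  have hcomp : (g ∘ f.symm) ∘ f = g := funext fun y => congrArg g (f.symm_apply_apply y)
  have hderiv := mvfderiv_comp_apply x (mdifferentiableAt_comp_symm f hg)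
    (mdifferentiableAt_diffeo f x) X
  rw [hcomp] at hderiv
  exact hderiv.symm

theorem mpullback_eq_diffeoDeriv_symm (W : Π y : M', TangentSpace (𝓡 n') y) (x : M) :
    VectorField.mpullback (𝓡 n) (𝓡 n') f W x = (diffeoDeriv f x).symm (W (f x)) :=
  DFunLike.congr_fun (ContinuousLinearMap.inverse_equiv (diffeoDeriv f x)) (W (f x))

theorem diffeoDeriv_symm_eq_mfderiv (x : M) :
    (((diffeoDeriv f x).symm : TangentSpace (𝓡 n') (f x) →L[ℝ] TangentSpace (𝓡 n) x) :
      EuclideanSpace ℝ (Fin n') →L[ℝ] EuclideanSpace ℝ (Fin n)) =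
    mfderiv (𝓡 n') (𝓡 n) f.symm (f x) := by
  have hcomp := mfderiv_comp (I' := 𝓡 n') x
    (mdifferentiableAt_diffeo f.symm (f x)) (mdifferentiableAt_diffeo f x)
  have hid : f.symm ∘ f = id := funext f.symm_apply_apply
  rw [hid, mfderiv_id] at hcomp
  refine ContinuousLinearMap.ext fun Y => ?_
  obtain ⟨X, rfl⟩ := (diffeoDeriv f x).surjective Y
  exact ((diffeoDeriv f x).symm_apply_apply X).trans (DFunLike.congr_fun hcomp X)

theorem pushforwardAt_inj
    {S S' : Π x : M, TangentSpace (𝓡 n) x → TangentSpace (𝓡 n) x → TangentSpace (𝓡 n) x} {x : M} :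
    pushforwardAt f S x = pushforwardAt f S' x ↔ S x = S' x := by
  refine ⟨fun h => ?_, fun h => by unfold pushforwardAt; rw [h]⟩
  funext X Y
  have hXY := congrFun (congrFun h (diffeoDeriv f x X)) (diffeoDeriv f x Y)
  simpa only [pushforwardAt, ContinuousLinearEquiv.symm_apply_apply,
    (diffeoDeriv f x).injective.eq_iff] using hXY

theorem IsHolomorphic.diffeoDeriv_apply {f : M ≃ₘ^∞⟮𝓡 n, 𝓡 n'⟯ M'}
    {A : Π x : M, TangentSpace (𝓡 n) x →L[ℝ] TangentSpace (𝓡 n) x}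
    {A' : Π y : M', TangentSpace (𝓡 n') y →L[ℝ] TangentSpace (𝓡 n') y}
    (hf : IsHolomorphic (𝓡 n) (𝓡 n') A A' f) (x : M) (X : TangentSpace (𝓡 n) x) :
    A' (f x) (diffeoDeriv f x X) = diffeoDeriv f x (A x X) :=
  DFunLike.congr_fun (hf.2 x) X

theorem IsHolomorphic.diffeoDeriv_symm_apply {f : M ≃ₘ^∞⟮𝓡 n, 𝓡 n'⟯ M'}
    {A : Π x : M, TangentSpace (𝓡 n) x →L[ℝ] TangentSpace (𝓡 n) x}
    {A' : Π y : M', TangentSpace (𝓡 n') y →L[ℝ] TangentSpace (𝓡 n') y}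
    (hf : IsHolomorphic (𝓡 n) (𝓡 n') A A' f) (x : M) (Y : TangentSpace (𝓡 n') (f x)) :
    (diffeoDeriv f x).symm (A' (f x) Y) = A x ((diffeoDeriv f x).symm Y) := by
  rw [ContinuousLinearEquiv.symm_apply_eq, ← hf.diffeoDeriv_apply,
    ContinuousLinearEquiv.apply_symm_apply]

theorem IsHolomorphic.mpullback_apply {f : M ≃ₘ^∞⟮𝓡 n, 𝓡 n'⟯ M'}
    {A : Π x : M, TangentSpace (𝓡 n) x →L[ℝ] TangentSpace (𝓡 n) x}
    {A' : Π y : M', TangentSpace (𝓡 n') y →L[ℝ] TangentSpace (𝓡 n') y}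
    (hf : IsHolomorphic (𝓡 n) (𝓡 n') A A' f) (W : Π y : M', TangentSpace (𝓡 n') y) :
    (VectorField.mpullback (𝓡 n) (𝓡 n') f fun y => A' y (W y)) =
      fun x => A x (VectorField.mpullback (𝓡 n) (𝓡 n') f W x) := by
  funext x
  rw [mpullback_eq_diffeoDeriv_symm, mpullback_eq_diffeoDeriv_symm, hf.diffeoDeriv_symm_apply]

theorem pairing_cotangentLift (W : Π y : M', TangentSpace (𝓡 n') y) :
    pairing W ∘ cotangentLift f = pairing (VectorField.mpullback (𝓡 n) (𝓡 n') f W) :=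
  funext fun ξ => congrArg ξ.2 (mpullback_eq_diffeoDeriv_symm f W ξ.proj).symm

theorem mpullback_symm_apply (Z : Π x : M, TangentSpace (𝓡 n) x) (x : M) :
    VectorField.mpullback (𝓡 n') (𝓡 n) f.symm Z (f x) = diffeoDeriv f x (Z x) := by
  have hinv : (ContinuousLinearMap.inverse (mfderiv (𝓡 n') (𝓡 n) f.symm (f x)) :
      EuclideanSpace ℝ (Fin n) →L[ℝ] EuclideanSpace ℝ (Fin n')) =
      (diffeoDeriv f x : TangentSpace (𝓡 n) x →L[ℝ] TangentSpace (𝓡 n') (f x)) :=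
    (congrArg ContinuousLinearMap.inverse (diffeoDeriv_symm_eq_mfderiv f x)).symm.trans
      (ContinuousLinearMap.inverse_equiv (diffeoDeriv f x).symm)
  have hZ : (Z (f.symm (f x)) : EuclideanSpace ℝ (Fin n)) = Z x :=
    congrArg (fun y => (Z y : EuclideanSpace ℝ (Fin n))) (f.symm_apply_apply x)
  exact (DFunLike.congr_fun hinv (Z (f.symm (f x)))).trans (congrArg (diffeoDeriv f x) hZ)

theorem mpullback_symm_mpullback (W : Π y : M', TangentSpace (𝓡 n') y) :
    VectorField.mpullback (𝓡 n') (𝓡 n) f.symm (VectorField.mpullback (𝓡 n) (𝓡 n') f W) = W := by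
  funext y
  obtain ⟨x, rfl⟩ : ∃ x, f x = y := ⟨f.symm y, f.apply_symm_apply y⟩
  rw [mpullback_symm_apply, mpullback_eq_diffeoDeriv_symm,
    ContinuousLinearEquiv.apply_symm_apply]

variable [IsManifold (𝓡 n) ∞ M] [IsManifold (𝓡 n') ∞ M']

theorem SmoothField.mpullback {W : Π y : M', TangentSpace (𝓡 n') y} (hW : SmoothField W) :
    SmoothField (VectorField.mpullback (𝓡 n) (𝓡 n') f W) :=
  ContMDiff.mpullback_vectorField (n := ∞) hW f.contMDiff (fun x => ⟨diffeoDeriv f x, rfl⟩)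
    (by simp)

theorem DifferentiableFieldAt.mpullback {W : Π y : M', TangentSpace (𝓡 n') y} {x : M}
    (hW : DifferentiableFieldAt W (f x)) :
    DifferentiableFieldAt (VectorField.mpullback (𝓡 n) (𝓡 n') f W) x :=
  MDifferentiableAt.mpullback_vectorField (n := ∞) hW f.contMDiff.contMDiffAt
    ⟨diffeoDeriv f x, rfl⟩ ENat.LEInfty.out

theorem DifferentiableFieldAt.mpullback_symm {Z : Π x : M, TangentSpace (𝓡 n) x} {x : M}
    (hZ : DifferentiableFieldAt Z x) :
    DifferentiableFieldAt (VectorField.mpullback (𝓡 n') (𝓡 n) f.symm Z) (f x) :=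
  DifferentiableFieldAt.mpullback f.symm (by rwa [f.symm_apply_apply])

theorem diffeoDeriv_symm_mlieBracket {W W' : Π y : M', TangentSpace (𝓡 n') y} {x : M}
    (hW : DifferentiableFieldAt W (f x)) (hW' : DifferentiableFieldAt W' (f x)) :
    (diffeoDeriv f x).symm (VectorField.mlieBracket (𝓡 n') W W' (f x)) =
      VectorField.mlieBracket (𝓡 n) (VectorField.mpullback (𝓡 n) (𝓡 n') f W)
        (VectorField.mpullback (𝓡 n) (𝓡 n') f W') x := by
  have : IsManifold (𝓡 n) (minSmoothness ℝ 3) M :=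
    IsManifold.of_le (n := ∞) (by simpa using ENat.LEInfty.out)
  have : IsManifold (𝓡 n') (minSmoothness ℝ 3) M' :=
    IsManifold.of_le (n := ∞) (by simpa using ENat.LEInfty.out)
  rw [← mpullback_eq_diffeoDeriv_symm f (VectorField.mlieBracket (𝓡 n') W W')]
  exact VectorField.mpullback_mlieBracket (n := ∞) hW hW' f.contMDiff.contMDiffAt
    (by simpa using ENat.LEInfty.out)

/-- The pullback `f^*∇'` of a connection along a diffeomorphism `f`: at `x` and for `X ∈ T_x M`,
`(f^*∇')_X Z = (d_x f)⁻¹ (∇'_{df X} f_*Z)`, where `f_*Z` is encoded as the pullback of the vector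
field `Z` along `f⁻¹`. -/
noncomputable def pullbackConnection (cov' : AffineConnection n' M') : AffineConnection n M where
  toFun Z x :=
    ((diffeoDeriv f x).symm : TangentSpace (𝓡 n') (f x) →L[ℝ] TangentSpace (𝓡 n) x) ∘L
      cov' (VectorField.mpullback (𝓡 n') (𝓡 n) f.symm Z) (f x) ∘L
        (diffeoDeriv f x : TangentSpace (𝓡 n) x →L[ℝ] TangentSpace (𝓡 n') (f x))
  isCovariantDerivativeOnUniv :=
    { add := fun {σ σ' x} hσ hσ' _ => by
        rw [VectorField.mpullback_add, cov'.isCovariantDerivativeOn.add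
          (DifferentiableFieldAt.mpullback_symm f hσ) (DifferentiableFieldAt.mpullback_symm f hσ')]
        refine ContinuousLinearMap.ext fun X => ?_
        exact map_add (diffeoDeriv f x).symm _ _
      leibniz := fun {σ g x} hσ hg _ => by
        rw [VectorField.mpullback_smul, cov'.isCovariantDerivativeOn.leibniz
          (DifferentiableFieldAt.mpullback_symm f hσ) (mdifferentiableAt_comp_symm f hg)]
        refine ContinuousLinearMap.ext fun X => ?_
        have hd := mvfderiv_comp_symm_diffeoDeriv f hg X
        have hσx := (diffeoDeriv f x).symm_apply_eq.2 (mpullback_symm_apply f σ x)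
        have hgx : (g ∘ f.symm) (f x) = g x := congrArg g (f.symm_apply_apply x)
        simp only [ContinuousLinearMap.comp_apply, add_apply,
          smul_apply, ContinuousLinearMap.smulRight_apply, map_add, map_smul,
          ContinuousLinearEquiv.coe_coe, hσx, hgx, hd] }

theorem pullbackConnection_mpullback (cov' : AffineConnection n' M')
    (W : Π y : M', TangentSpace (𝓡 n') y) (x : M) (X : TangentSpace (𝓡 n) x) :
    pullbackConnection f cov' (VectorField.mpullback (𝓡 n) (𝓡 n') f W) x X =
      (diffeoDeriv f x).symm (cov' W (f x) (diffeoDeriv f x X)) := by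
  change (diffeoDeriv f x).symm (cov' (VectorField.mpullback (𝓡 n') (𝓡 n) f.symm
    (VectorField.mpullback (𝓡 n) (𝓡 n') f W)) (f x) (diffeoDeriv f x X)) = _
  rw [mpullback_symm_mpullback]

end Diffeo

theorem inCoordinates_trivial_apply {B B' F G : Type*} [TopologicalSpace B] [TopologicalSpace B']
    [NormedAddCommGroup F] [NormedSpace ℝ F] [NormedAddCommGroup G] [NormedSpace ℝ G]
    {E : B → Type*} [∀ x, AddCommGroup (E x)] [∀ x, Module ℝ (E x)]
    [∀ x, TopologicalSpace (E x)] [TopologicalSpace (TotalSpace F E)] [FiberBundle F E]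
    [VectorBundle ℝ F E] (x₀ x : B) (y₀ y : B') (φ : E x →L[ℝ] G) (v : F) :
    ContinuousLinearMap.inCoordinates F E G (Bundle.Trivial B' G) x₀ x y₀ y φ v =
      φ ((trivializationAt F E x₀).symmL ℝ x v) := by
  have hid : (trivializationAt G (Bundle.Trivial B' G) y₀).continuousLinearMapAt ℝ y =
      ContinuousLinearMap.id ℝ G := Bundle.Trivial.continuousLinearMapAt_trivialization ℝ B' G y
  rw [ContinuousLinearMap.inCoordinates, hid]
  rfl

section Lift

variable {n : ℕ} {M : Type*} [TopologicalSpace M]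
    [ChartedSpace (EuclideanSpace ℝ (Fin n)) M] [IsManifold (𝓡 n) ∞ M]
    {n' : ℕ} {M' : Type*} [TopologicalSpace M']
    [ChartedSpace (EuclideanSpace ℝ (Fin n')) M'] [IsManifold (𝓡 n') ∞ M']
    (f : M ≃ₘ^∞⟮𝓡 n, 𝓡 n'⟯ M')

theorem contMDiffAt_inTangentCoordinates_diffeoDeriv_symm (x₀ : M) :
    ContMDiffAt (𝓡 n) 𝓘(ℝ, EuclideanSpace ℝ (Fin n') →L[ℝ] EuclideanSpace ℝ (Fin n)) ∞
      (inTangentCoordinates (𝓡 n') (𝓡 n) f id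
        (fun x => ((diffeoDeriv f x).symm :
          TangentSpace (𝓡 n') (f x) →L[ℝ] TangentSpace (𝓡 n) x)) x₀) x₀ := by
  have hsmooth := ContMDiffAt.mfderiv (n := ∞) (m := ∞) (I := 𝓡 n') (I' := 𝓡 n) (J := 𝓡 n)
    (x₀ := x₀) (fun _ : M => f.symm) f
    (f.symm.contMDiff.contMDiffAt.comp (x₀, f x₀) contMDiffAt_snd)
    f.contMDiff.contMDiffAt (by simp)
  have hid : (fun x => f.symm (f x)) = id := funext f.symm_apply_apply
  have hderiv : (fun x => mfderiv (𝓡 n') (𝓡 n) f.symm (f x)) = fun x =>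
      (((diffeoDeriv f x).symm : TangentSpace (𝓡 n') (f x) →L[ℝ] TangentSpace (𝓡 n) x) :
        EuclideanSpace ℝ (Fin n') →L[ℝ] EuclideanSpace ℝ (Fin n)) :=
    funext fun x => (diffeoDeriv_symm_eq_mfderiv f x).symm
  rw [hid] at hsmooth
  exact hderiv ▸ hsmooth

theorem inCoordinates_cotangentLift (x₀ : M) (ξ : CotangentBundle n M)
    (hξ : ξ.proj ∈
      (trivializationAt (EuclideanSpace ℝ (Fin n)) (TangentSpace (𝓡 n)) x₀).baseSet) :
    ContinuousLinearMap.inCoordinates (EuclideanSpace ℝ (Fin n')) (TangentSpace (𝓡 n')) ℝ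
        (Bundle.Trivial M' ℝ) (f x₀) (f ξ.proj) (f x₀) (f ξ.proj) (cotangentLift f ξ).2 =
      ContinuousLinearMap.inCoordinates (EuclideanSpace ℝ (Fin n)) (TangentSpace (𝓡 n)) ℝ
        (Bundle.Trivial M ℝ) x₀ ξ.proj x₀ ξ.proj ξ.2 ∘L
      inTangentCoordinates (𝓡 n') (𝓡 n) f id
        (fun x => ((diffeoDeriv f x).symm :
          TangentSpace (𝓡 n') (f x) →L[ℝ] TangentSpace (𝓡 n) x)) x₀ ξ.proj := by
  refine ContinuousLinearMap.ext fun v => ?_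
  rw [ContinuousLinearMap.comp_apply, inCoordinates_trivial_apply]
  refine (inCoordinates_trivial_apply (f x₀) (f ξ.proj) (f x₀) (f ξ.proj)
    (cotangentLift f ξ).2 v).trans ?_
  exact congrArg ξ.2 ((trivializationAt (EuclideanSpace ℝ (Fin n)) (TangentSpace (𝓡 n))
    x₀).symmL_continuousLinearMapAt (R := ℝ) hξ _).symm

theorem contMDiff_cotangentLift :
    ContMDiff (cotangentModel n) (cotangentModel n') ∞ (cotangentLift f) := by
  intro ξ₀
  have hp : ContMDiffAt (cotangentModel n) (𝓡 n) ∞ (fun ξ : CotangentBundle n M => ξ.proj) ξ₀ :=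
    contMDiff_proj (fun x : M => CotangentSpace n x) ξ₀
  have hfp : ContMDiffAt (cotangentModel n) (𝓡 n') ∞
      (fun ξ : CotangentBundle n M => f ξ.proj) ξ₀ :=
    f.contMDiff.contMDiffAt.comp ξ₀ hp
  have hξ := ((contMDiffAt_hom_bundle (n := ∞) (IB := 𝓡 n) (IM := cotangentModel n)
    (E₁ := (TangentSpace (𝓡 n) : M → Type _))
    (E₂ := Bundle.Trivial M ℝ) (fun ξ : CotangentBundle n M => ξ) (x₀ := ξ₀)).1 contMDiffAt_id).2
  have hf := (contMDiffAt_inTangentCoordinates_diffeoDeriv_symm f ξ₀.proj).comp ξ₀ hp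
  refine (contMDiffAt_hom_bundle (n := ∞) (IB := 𝓡 n') (IM := cotangentModel n)
    (E₁ := (TangentSpace (𝓡 n') : M' → Type _))
    (E₂ := Bundle.Trivial M' ℝ) (cotangentLift f)).2 ⟨hfp, ?_⟩
  refine (hξ.clm_comp hf).congr_of_eventuallyEq ?_
  have hbase := hp.continuousAt.eventually ((trivializationAt (EuclideanSpace ℝ (Fin n))
    (TangentSpace (𝓡 n)) ξ₀.proj).open_baseSet.mem_nhds
    (FiberBundle.mem_baseSet_trivializationAt' _))
  exact hbase.mono fun ξ hξ => inCoordinates_cotangentLift f ξ₀.proj ξ hξ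

theorem mdifferentiableAt_cotangentLift (ξ : CotangentBundle n M) :
    MDifferentiableAt (cotangentModel n) (cotangentModel n') (cotangentLift f) ξ :=
  (contMDiff_cotangentLift f).mdifferentiableAt (by simp)

/-- The differential of the lift `f̃`. -/
noncomputable def cotangentLiftDeriv (ξ : CotangentBundle n M) :
    TangentSpace (cotangentModel n) ξ →L[ℝ] TangentSpace (cotangentModel n') (cotangentLift f ξ) :=
  mfderiv (cotangentModel n) (cotangentModel n') (cotangentLift f) ξ

theorem projDeriv_cotangentLiftDeriv (ξ : CotangentBundle n M)
    (V : TangentSpace (cotangentModel n) ξ) :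
    projDeriv (cotangentLift f ξ) (cotangentLiftDeriv f ξ V) =
      diffeoDeriv f ξ.proj (projDeriv ξ V) := by
  have hproj_lift := mfderiv_comp (I' := cotangentModel n') ξ
    (g := (TotalSpace.proj : CotangentBundle n' M' → M'))
    (mdifferentiableAt_proj (E := fun x : M' => CotangentSpace n' x))
    (mdifferentiableAt_cotangentLift f ξ)
  have hf_proj := mfderiv_comp (I' := 𝓡 n) ξ (g := f)
    (f := (TotalSpace.proj : CotangentBundle n M → M))
    (mdifferentiableAt_diffeo f ξ.proj)
    (mdifferentiableAt_proj (E := fun x : M => CotangentSpace n x))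
  exact DFunLike.congr_fun (hproj_lift.symm.trans hf_proj) V

theorem mvfderiv_pairing_cotangentLiftDeriv {W : Π y : M', TangentSpace (𝓡 n') y}
    {ξ : CotangentBundle n M} (hW : DifferentiableFieldAt W (f ξ.proj))
    (V : TangentSpace (cotangentModel n) ξ) :
    mvfderiv (cotangentModel n') (pairing W) (cotangentLift f ξ) (cotangentLiftDeriv f ξ V) =
      mvfderiv (cotangentModel n) (pairing (VectorField.mpullback (𝓡 n) (𝓡 n') f W)) ξ V := by
  rw [← pairing_cotangentLift]
  exact (mvfderiv_comp_apply ξ (pairing_mdiff hW) (mdifferentiableAt_cotangentLift f ξ) V).symm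

section Naturality

variable {f} {J : Π x : M, TangentSpace (𝓡 n) x →L[ℝ] TangentSpace (𝓡 n) x}
    {J' : Π y : M', TangentSpace (𝓡 n') y →L[ℝ] TangentSpace (𝓡 n') y} [T2Space M']

theorem connector_cotangentLiftDeriv (f : M ≃ₘ^∞⟮𝓡 n, 𝓡 n'⟯ M') (cov' : AffineConnection n' M')
    (ξ : CotangentBundle n M) (z : TangentSpace (𝓡 n') (f ξ.proj))
    (V : TangentSpace (cotangentModel n) ξ) :
    connector cov' (cotangentLift f ξ) z (cotangentLiftDeriv f ξ V) =
      connector (pullbackConnection f cov') ξ ((diffeoDeriv f ξ.proj).symm z) V := by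
  obtain ⟨W, hW, rfl⟩ := exists_smoothField z
  rw [← mpullback_eq_diffeoDeriv_symm, connector_apply _ ξ (hW.mpullback f),
    ← mvfderiv_pairing_cotangentLiftDeriv f (hW.mdiff _), pullbackConnection_mpullback,
    ← projDeriv_cotangentLiftDeriv]
  exact connector_apply cov' (cotangentLift f ξ) hW _

theorem pushforwardAt_tensorS_pullbackConnection {J : DifferentiableEndomorphism n M}
    {J' : DifferentiableEndomorphism n' M'}
    (hf : IsHolomorphic (𝓡 n) (𝓡 n') J.toFun J'.toFun f) (cov' : AffineConnection n' M')
    (x : M) :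
    pushforwardAt f (J.tensorS (pullbackConnection f cov')) x = J'.tensorS cov' (f x) := by
  funext X Y
  refine ((diffeoDeriv f x).symm_apply_eq.1 ?_).symm
  obtain ⟨X, hX, rfl⟩ := exists_smoothField X
  obtain ⟨Y, hY, rfl⟩ := exists_smoothField Y
  have hX := hX.mdiff (f x)
  have hY := hY.mdiff (f x)
  rw [← mpullback_eq_diffeoDeriv_symm, ← mpullback_eq_diffeoDeriv_symm,
    J.tensorS_apply _ (DifferentiableFieldAt.mpullback f hX) (DifferentiableFieldAt.mpullback f hY),
    J'.tensorS_apply cov' hX hY, ← hf.mpullback_apply, ← hf.mpullback_apply,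
    pullbackConnection_mpullback, pullbackConnection_mpullback, ← hf.diffeoDeriv_apply,
    mpullback_eq_diffeoDeriv_symm, ContinuousLinearEquiv.apply_symm_apply,
    ← diffeoDeriv_symm_mlieBracket f hX hY,
    ← diffeoDeriv_symm_mlieBracket f (J'.differentiableFieldAt_apply hX) hY,
    ← hf.diffeoDeriv_symm_apply]
  simp only [map_add, map_sub]

variable [T2Space M]

theorem cotangentLiftDeriv_injective (f : M ≃ₘ^∞⟮𝓡 n, 𝓡 n'⟯ M')
    (cov' : AffineConnection n' M') (ξ : CotangentBundle n M) :
    Function.Injective (cotangentLiftDeriv f ξ) := by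
  intro V W h
  refine eq_of_connector (pullbackConnection f cov') ?_ fun z => ?_
  · refine (diffeoDeriv f ξ.proj).injective ?_
    rw [← projDeriv_cotangentLiftDeriv, h, projDeriv_cotangentLiftDeriv]
  · obtain ⟨z, rfl⟩ := (diffeoDeriv f ξ.proj).symm.surjective z
    rw [← connector_cotangentLiftDeriv, h, connector_cotangentLiftDeriv]

theorem cotangentLiftDeriv_productLift (hf : IsHolomorphic (𝓡 n) (𝓡 n') J J' f)
    (cov' : AffineConnection n' M') (ξ : CotangentBundle n M)
    (V : TangentSpace (cotangentModel n) ξ) :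
    cotangentLiftDeriv f ξ (productLift J (pullbackConnection f cov') ξ V) =
      productLift J' cov' (cotangentLift f ξ) (cotangentLiftDeriv f ξ V) := by
  have hA := isProductLift_productLift J (pullbackConnection f cov') ξ
  have hA' := isProductLift_productLift J' cov' (cotangentLift f ξ)
  refine eq_of_connector cov' ?_ fun z => ?_
  · rw [hA'.projDeriv_apply, projDeriv_cotangentLiftDeriv, projDeriv_cotangentLiftDeriv,
      hA.projDeriv_apply]
    exact (hf.diffeoDeriv_apply ξ.proj _).symm
  · change TangentSpace (𝓡 n') (f ξ.proj) at z
    calc connector cov' (cotangentLift f ξ) z (cotangentLiftDeriv f ξ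
          (productLift J (pullbackConnection f cov') ξ V))
      _ = connector (pullbackConnection f cov') ξ ((diffeoDeriv f ξ.proj).symm z)
            (productLift J (pullbackConnection f cov') ξ V) :=
        connector_cotangentLiftDeriv f cov' ξ z _
      _ = connector (pullbackConnection f cov') ξ ((diffeoDeriv f ξ.proj).symm (J' (f ξ.proj) z))
            V := by rw [hA.connector_apply, hf.diffeoDeriv_symm_apply]
      _ = connector cov' (cotangentLift f ξ) (J' (f ξ.proj) z) (cotangentLiftDeriv f ξ V) :=
        (connector_cotangentLiftDeriv f cov' ξ _ V).symm
      _ = connector cov' (cotangentLift f ξ) z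
            (productLift J' cov' (cotangentLift f ξ) (cotangentLiftDeriv f ξ V)) :=
        (hA'.connector_apply z _).symm

theorem isHolomorphic_cotangentLift_iff_eq_productLift
    (hf : IsHolomorphic (𝓡 n) (𝓡 n') J J' f) (cov' : AffineConnection n' M')
    (A : Π ξ : CotangentBundle n M,
      TangentSpace (cotangentModel n) ξ →L[ℝ] TangentSpace (cotangentModel n) ξ) :
    IsHolomorphic (cotangentModel n) (cotangentModel n') A (productLift J' cov')
        (cotangentLift f) ↔ A = productLift J (pullbackConnection f cov') := by
  constructor
  · intro h
    funext ξ
    refine ContinuousLinearMap.ext fun V => cotangentLiftDeriv_injective f cov' ξ ?_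
    rw [cotangentLiftDeriv_productLift hf]
    exact (DFunLike.congr_fun (h.2 ξ) V).symm
  · rintro rfl
    exact ⟨contMDiff_cotangentLift f, fun ξ => ContinuousLinearMap.ext fun V =>
      (cotangentLiftDeriv_productLift hf cov' ξ V).symm⟩

theorem isHolomorphic_of_isHolomorphic_cotangentLift {cov : AffineConnection n M}
    {cov' : AffineConnection n' M'}
    (h : IsHolomorphic (cotangentModel n) (cotangentModel n') (productLift J cov)
      (productLift J' cov') (cotangentLift f)) :
    IsHolomorphic (𝓡 n) (𝓡 n') J J' f := by
  refine ⟨f.contMDiff, fun x => ContinuousLinearMap.ext fun X => ?_⟩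
  let ξ : CotangentBundle n M := ⟨x, 0⟩
  obtain ⟨V, rfl⟩ := projDeriv_surjective ξ X
  have hV : productLift J' cov' (cotangentLift f ξ) (cotangentLiftDeriv f ξ V) =
    cotangentLiftDeriv f ξ (productLift J cov ξ V) := DFunLike.congr_fun (h.2 ξ) V
  have hproj := congrArg (projDeriv (cotangentLift f ξ)) hV
  rw [(isProductLift_productLift J' cov' _).projDeriv_apply, projDeriv_cotangentLiftDeriv,
    projDeriv_cotangentLiftDeriv, (isProductLift_productLift J cov ξ).projDeriv_apply] at hproj
  exact hproj

theorem isHolomorphic_cotangentLift_iff {J : DifferentiableEndomorphism n M}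
    {J' : DifferentiableEndomorphism n' M'} {cov : AffineConnection n M}
    {cov' : AffineConnection n' M'} :
    IsHolomorphic (cotangentModel n) (cotangentModel n') (productLift J.toFun cov)
        (productLift J'.toFun cov') (cotangentLift f) ↔
      IsHolomorphic (𝓡 n) (𝓡 n') J.toFun J'.toFun f ∧
        ∀ x, pushforwardAt f (J.tensorS cov) x = J'.tensorS cov' (f x) := by
  refine (and_iff_right_of_imp isHolomorphic_of_isHolomorphic_cotangentLift).symm.trans
    (and_congr_right fun hf => ?_)
  rw [isHolomorphic_cotangentLift_iff_eq_productLift hf, productLift_eq_iff_tensorS_eq]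
  simp only [← pushforwardAt_tensorS_pullbackConnection hf, pushforwardAt_inj]
  exact funext_iff

end Naturality

end Lift

end CotangentLift

open CotangentLift in
theorem theorem2_general
    {n : ℕ} {M : Type*} [TopologicalSpace M] [T2Space M]
    [ChartedSpace (EuclideanSpace ℝ (Fin n)) M] [IsManifold (𝓡 n) ∞ M]
    (J : Π x : M, TangentSpace (𝓡 n) x →L[ℝ] TangentSpace (𝓡 n) x) (cov : AffineConnection n M)
    {n₁ : ℕ} {M₁ : Type*} [TopologicalSpace M₁] [T2Space M₁]
    [ChartedSpace (EuclideanSpace ℝ (Fin n₁)) M₁] [IsManifold (𝓡 n₁) ∞ M₁]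
    (J₁ : DifferentiableEndomorphism n₁ M₁) (cov₁ : AffineConnection n₁ M₁)
    {n₂ : ℕ} {M₂ : Type*} [TopologicalSpace M₂] [T2Space M₂]
    [ChartedSpace (EuclideanSpace ℝ (Fin n₂)) M₂] [IsManifold (𝓡 n₂) ∞ M₂]
    (J₂ : DifferentiableEndomorphism n₂ M₂) (cov₂ : AffineConnection n₂ M₂)
    (f : M₁ ≃ₘ^∞⟮𝓡 n₁, 𝓡 n₂⟯ M₂) :
    IsHolomorphic (cotangentModel n) (𝓡 n) (productLift J cov) J
        (fun ξ : CotangentBundle n M => ξ.proj) ∧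
    IsHolomorphic (𝓡 n) (cotangentModel n) J (productLift J cov)
        (fun x : M => (⟨x, 0⟩ : CotangentBundle n M)) ∧
    (IsHolomorphic (cotangentModel n₁) (cotangentModel n₂) (productLift J₁.toFun cov₁)
        (productLift J₂.toFun cov₂) (cotangentLift f) ↔
      IsHolomorphic (𝓡 n₁) (𝓡 n₂) J₁.toFun J₂.toFun f ∧
        ∀ x : M₁, pushforwardAt f (J₁.tensorS cov₁) x = J₂.tensorS cov₂ (f x)) :=
  ⟨isHolomorphic_proj J cov, isHolomorphic_zeroSection J cov, isHolomorphic_cotangentLift_iff⟩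

theorem theorem2
    {n : ℕ} {M : Type*} [TopologicalSpace M] [T2Space M]
    [ChartedSpace (EuclideanSpace ℝ (Fin n)) M] [IsManifold (𝓡 n) ∞ M]
    (J : CotangentLift.AlmostComplexStructure n M) (cov : CotangentLift.AffineConnection n M)
    {n₁ : ℕ} {M₁ : Type*} [TopologicalSpace M₁] [T2Space M₁]
    [ChartedSpace (EuclideanSpace ℝ (Fin n₁)) M₁] [IsManifold (𝓡 n₁) ∞ M₁]
    (J₁ : CotangentLift.AlmostComplexStructure n₁ M₁)
    (cov₁ : CotangentLift.AffineConnection n₁ M₁)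
    {n₂ : ℕ} {M₂ : Type*} [TopologicalSpace M₂] [T2Space M₂]
    [ChartedSpace (EuclideanSpace ℝ (Fin n₂)) M₂] [IsManifold (𝓡 n₂) ∞ M₂]
    (J₂ : CotangentLift.AlmostComplexStructure n₂ M₂)
    (cov₂ : CotangentLift.AffineConnection n₂ M₂)
    (f : M₁ ≃ₘ^∞⟮𝓡 n₁, 𝓡 n₂⟯ M₂) :
    CotangentLift.IsHolomorphic (CotangentLift.cotangentModel n) (𝓡 n)
        (CotangentLift.generalizedHorizontalLift J cov) J.toFun
        (fun ξ : CotangentLift.CotangentBundle n M => ξ.proj) ∧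
    CotangentLift.IsHolomorphic (𝓡 n) (CotangentLift.cotangentModel n)
        J.toFun (CotangentLift.generalizedHorizontalLift J cov)
        (fun x : M => (⟨x, 0⟩ : CotangentLift.CotangentBundle n M)) ∧
    (CotangentLift.IsHolomorphic (CotangentLift.cotangentModel n₁)
        (CotangentLift.cotangentModel n₂)
        (CotangentLift.generalizedHorizontalLift J₁ cov₁)
        (CotangentLift.generalizedHorizontalLift J₂ cov₂) (CotangentLift.cotangentLift f) ↔
      CotangentLift.IsHolomorphic (𝓡 n₁) (𝓡 n₂) J₁.toFun J₂.toFun f ∧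
        ∀ x : M₁, CotangentLift.pushforwardAt f (CotangentLift.tensorS J₁ cov₁) x =
          CotangentLift.tensorS J₂ cov₂ (f x)) :=
  theorem2_general J.toFun cov J₁.toDifferentiableEndomorphism cov₁
    J₂.toDifferentiableEndomorphism cov₂ f
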